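/- Let $P=P_3\times P_q\subset\mathbb R^2\times\mathbb R^2$ be the product of a triangle and a convex $q$-gon, $q\ge 3$ (so $P$ is a simple $4$-polytope with $m=q+3$ facets, and $P=P_3\times P_{m-3}$). Let $\lambda\colon\{F_1,\dots,F_m\}\to\mathbb Z_2^4$ be any mod $2$ characteristic map on the facets of $P$, i.e. whenever $F_{i_1}\cap\dots\cap F_{i_k}\ne\varnothing$ for distinct facets, the vectors $\lambda(F_{i_1}),\dots,\lambda(F_{i_k})$ are linearly independent over $\mathbb Z_2$. Let $$M(P,\lambda)=(\mathbb Z_2^4\times P)/\!\sim,\qquad (g,p)\sim(h,p')\iff p=p' \text{ and } g+h\in\langle \lambda(F_i)\mid p\in F_i\rangle,$$ be the corresponding small cover, a closed $4$-manifold. Then $M(P,\lambda)$ is not cohomologically symplectic: there is no class $a\in H^2(M(P,\lambda);\mathbb Q)$ with $a^2\neq 0$ in $H^4(M(P,\lambda);\mathbb Q)$. In other words, no small cover over $P_3\times P_{m-3}$ is cohomologically symplectic. -/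

import Mathlib

/-! ## Cohomology of simplicial sets and singular cohomology, with cup products -/

namespace SimplicialCohomology

open CategoryTheory Opposite

universe u

variable (R : Type) [CommRing R] (S : SSet.{u})

/-- The `n`-simplices of a simplicial set. -/
abbrev Simplex (S : SSet.{u}) (n : ℕ) : Type u := S.obj (op (SimplexCategory.mk n))

/-- `n`-cochains of a simplicial set with coefficients in `R`. -/
abbrev Cochain (n : ℕ) : Type u := Simplex S n → R

/-- The coboundary `(df)(σ) = ∑ i, (-1)^i f(∂ᵢ σ)`. -/
def coboundary (n : ℕ) : Cochain R S n →ₗ[R] Cochain R S (n + 1) where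
  toFun f := fun σ => ∑ i : Fin (n + 2), (-1) ^ (i : ℕ) * f (S.δ i σ)
  map_add' f g := by
    funext σ
    simp [mul_add, Finset.sum_add_distrib]
  map_smul' r f := by
    funext σ
    simp [Finset.mul_sum, mul_left_comm]

/-- The cocycles `Zⁿ`. -/
def cocycles (n : ℕ) : Submodule R (Cochain R S n) :=
  LinearMap.ker (coboundary R S n)

/-- The coboundaries `Bⁿ`; there are none but zero in degree `0`. -/
def coboundaries : (n : ℕ) → Submodule R (Cochain R S n)
  | 0 => ⊥
  | n + 1 => LinearMap.range (coboundary R S n)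

/-- The cohomology `Hⁿ = Zⁿ / Bⁿ`. -/
abbrev Cohomology (n : ℕ) : Type u :=
  cocycles R S n ⧸ (coboundaries R S n).submoduleOf (cocycles R S n)

variable {R S}

/-- The face of an `n`-simplex spanned by its vertices `j, j + 1, …, j + l`. -/
def intervalFace {n : ℕ} (j l : ℕ) (h : j + l ≤ n) (σ : Simplex S n) : Simplex S l :=
  S.map (SimplexCategory.subinterval j l h).op σ

/-- The Alexander–Whitney cup product of cochains:
`(f ∪ g)(σ) = f(σ|[0,…,p]) g(σ|[p,…,p+q])`. -/
def cupCochain {p q n : ℕ} (h : p + q = n) (f : Cochain R S p) (g : Cochain R S q) :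
    Cochain R S n :=
  fun σ => f (intervalFace 0 p (by omega) σ) * g (intervalFace p q (by omega) σ)

lemma intervalFace_δ {n j l j' l' : ℕ} (i : Fin (n + 2)) (h : j + l ≤ n)
    (h' : j' + l' ≤ n + 1) (θ : SimplexCategory.mk l ⟶ SimplexCategory.mk l')
    (hθ : SimplexCategory.subinterval j l h ≫ SimplexCategory.δ i =
      θ ≫ SimplexCategory.subinterval j' l' h') (σ : Simplex S (n + 1)) :
    intervalFace j l h (S.δ i σ) = S.map θ.op (intervalFace j' l' h' σ) := by
  simp only [intervalFace, SimplicialObject.δ]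
  rw [← Functor.map_comp_apply, ← Functor.map_comp_apply, ← op_comp, ← op_comp, hθ]

lemma val_succAbove {n : ℕ} (i : Fin (n + 2)) (x : Fin (n + 1)) :
    (i.succAbove x : ℕ) = if (x : ℕ) < i then (x : ℕ) else x + 1 := by
  simp only [Fin.succAbove, Fin.lt_def, Fin.val_castSucc]
  split_ifs <;> rfl

lemma front_δ_low {n p : ℕ} (i : Fin (n + 2)) (i' : Fin (p + 2)) (hi : (i : ℕ) = i')
    (hp : p ≤ n) (σ : Simplex S (n + 1)) :
    intervalFace 0 p (by omega) (S.δ i σ) = S.δ i' (intervalFace 0 (p + 1) (by omega) σ) := by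
  refine intervalFace_δ i (by omega) (by omega) (SimplexCategory.δ i') ?_ σ
  ext x
  have hx : (x : ℕ) < p + 1 := x.2
  change (i.succAbove ⟨(x : Fin (p + 1)).val + 0, by omega⟩ : ℕ) =
    (i'.succAbove (x : Fin (p + 1)) : ℕ) + 0
  rw [val_succAbove, val_succAbove]
  simp only [hi, add_zero]

lemma face_δ_same {n j l : ℕ} (i : Fin (n + 2)) (hi : j + l < i) (hp : j + l ≤ n)
    (σ : Simplex S (n + 1)) :
    intervalFace j l hp (S.δ i σ) = intervalFace j l (by omega) σ := by
  refine (intervalFace_δ (j' := j) (l' := l) i hp (by omega) (𝟙 _) ?_ σ).trans (by simp)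
  ext x
  have hx : (x : ℕ) < l + 1 := x.2
  change (i.succAbove ⟨(x : Fin (l + 1)).val + j, by omega⟩ : ℕ) = (x : Fin (l + 1)).val + j
  rw [val_succAbove, if_pos (by dsimp only; omega)]

lemma face_δ_shift {n j l : ℕ} (i : Fin (n + 2)) (hi : (i : ℕ) ≤ j) (hp : j + l ≤ n)
    (σ : Simplex S (n + 1)) :
    intervalFace j l hp (S.δ i σ) = intervalFace (j + 1) l (by omega) σ := by
  refine (intervalFace_δ (j' := j + 1) (l' := l) i hp (by omega) (𝟙 _) ?_ σ).trans (by simp)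
  ext x
  have hx : (x : ℕ) < l + 1 := x.2
  change (i.succAbove ⟨(x : Fin (l + 1)).val + j, by omega⟩ : ℕ) = (x : Fin (l + 1)).val + (j + 1)
  rw [val_succAbove, if_neg (by dsimp only; omega), add_assoc]

lemma back_δ_high {n p q : ℕ} (i : Fin (n + 2)) (i' : Fin (q + 2)) (hi : (i : ℕ) = p + i')
    (hp : p + q ≤ n) (σ : Simplex S (n + 1)) :
    intervalFace p q hp (S.δ i σ) = S.δ i' (intervalFace p (q + 1) (by omega) σ) := by
  refine intervalFace_δ i (by omega) (by omega) (SimplexCategory.δ i') ?_ σ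
  ext x
  have hx : (x : ℕ) < q + 1 := x.2
  change (i.succAbove ⟨(x : Fin (q + 1)).val + p, by omega⟩ : ℕ) =
    (i'.succAbove (x : Fin (q + 1)) : ℕ) + p
  rw [val_succAbove, val_succAbove]
  split_ifs <;> dsimp only at * <;> omega

/-- The Leibniz rule. -/
lemma coboundary_cupCochain {p q n : ℕ} (h : p + q = n) (f : Cochain R S p)
    (g : Cochain R S q) :
    coboundary R S n (cupCochain h f g) =
      cupCochain (by omega : p + 1 + q = n + 1) (coboundary R S p f) g +
        (-1) ^ p • cupCochain (by omega : p + (q + 1) = n + 1) f (coboundary R S q g) := by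
  funext σ
  subst h
  simp only [coboundary, cupCochain, LinearMap.coe_mk, AddHom.coe_mk, Pi.add_apply, Pi.smul_apply]
  rw [← Fin.sum_congr' _ (by omega : (p + 1) + (q + 1) = p + q + 2), Fin.sum_univ_add,
    Fin.sum_univ_castSucc (n := p + 1), Fin.sum_univ_succ (n := q + 1), add_mul, mul_add,
    Finset.sum_mul, Finset.mul_sum]
  have e1 : ∀ i : Fin (p + 1), intervalFace p q (le_refl (p + q))
      (S.δ (Fin.cast (by omega : (p + 1) + (q + 1) = p + q + 2) (Fin.castAdd (q + 1) i)) σ) =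
      intervalFace (p + 1) q (by omega) σ := fun i => face_δ_shift _ (by simp; omega) _ σ
  have e2 : ∀ i : Fin (p + 1), intervalFace 0 p (by omega)
      (S.δ (Fin.cast (by omega : (p + 1) + (q + 1) = p + q + 2) (Fin.castAdd (q + 1) i)) σ) =
      S.δ i.castSucc (intervalFace 0 (p + 1) (by omega) σ) :=
    fun i => front_δ_low _ _ (by simp) (by omega) σ
  have e3 : ∀ i : Fin (q + 1), intervalFace p q (le_refl (p + q))
      (S.δ (Fin.cast (by omega : (p + 1) + (q + 1) = p + q + 2) (Fin.natAdd (p + 1) i)) σ) =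
      S.δ i.succ (intervalFace p (q + 1) (by omega) σ) :=
    fun i => back_δ_high _ _ (by simp; omega) _ σ
  have e4 : ∀ i : Fin (q + 1), intervalFace 0 p (by omega)
      (S.δ (Fin.cast (by omega : (p + 1) + (q + 1) = p + q + 2) (Fin.natAdd (p + 1) i)) σ) =
      intervalFace 0 p (by omega) σ := fun i => face_δ_same _ (by simp; omega) _ σ
  have e5 : S.δ (Fin.last (p + 1)) (intervalFace 0 (p + 1) (by omega : 0 + (p + 1) ≤ p + q + 1) σ)
      = intervalFace 0 p (by omega) σ := by
    rw [← front_δ_low (n := p + q) ⟨p + 1, by omega⟩ _ (by simp) (by omega) σ]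
    exact face_δ_same _ (by simp) _ σ
  have e6 : S.δ 0 (intervalFace p (q + 1) (by omega : p + (q + 1) ≤ p + q + 1) σ)
      = intervalFace (p + 1) q (by omega) σ := by
    rw [← back_δ_high (n := p + q) ⟨p, by omega⟩ _ (by simp) (by omega) σ]
    exact face_δ_shift _ (by simp) _ σ
  simp only [e1, e2, e3, e4, e5, e6]
  simp only [Fin.val_cast, Fin.val_castAdd, Fin.val_natAdd, Fin.val_castSucc, Fin.val_last,
    Fin.val_succ, Fin.val_zero, smul_add, Finset.smul_sum]
  have s1 : ∀ x : R, (-1 : ℤ) ^ p • x = (-1) ^ p * x := fun x => by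
    simp [zsmul_eq_mul]
  simp only [s1]
  have s2 : ∀ i : Fin (q + 1), (-1 : R) ^ (p + 1 + (i : ℕ)) *
      (f (intervalFace 0 p (by omega) σ) * g (S.δ i.succ (intervalFace p (q + 1) (by omega) σ))) =
      (-1) ^ p * (f (intervalFace 0 p (by omega) σ) * ((-1) ^ ((i : ℕ) + 1) *
        g (S.δ i.succ (intervalFace p (q + 1) (by omega) σ)))) := fun i => by ring
  simp only [s2, mul_assoc]
  ring

lemma cupCochain_mem_cocycles {p q n : ℕ} (h : p + q = n) {f : Cochain R S p}
    {g : Cochain R S q} (hf : f ∈ cocycles R S p) (hg : g ∈ cocycles R S q) :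
    cupCochain h f g ∈ cocycles R S n := by
  rw [cocycles, LinearMap.mem_ker] at *
  rw [coboundary_cupCochain, hf, hg]
  funext σ
  simp [cupCochain]

lemma cupCochain_mem_coboundaries_left {p q n : ℕ} (h : p + q = n) {f : Cochain R S p}
    {g : Cochain R S q} (hf : f ∈ coboundaries R S p) (hg : g ∈ cocycles R S q) :
    cupCochain h f g ∈ coboundaries R S n := by
  cases p with
  | zero =>
    obtain rfl : f = 0 := hf
    convert (coboundaries R S n).zero_mem
    funext σ
    simp [cupCochain]
  | succ p =>
    obtain ⟨b, rfl⟩ := hf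
    obtain ⟨n, rfl⟩ : ∃ k, n = k + 1 := ⟨p + q, by omega⟩
    rw [cocycles, LinearMap.mem_ker] at hg
    refine ⟨cupCochain (by omega) b g, ?_⟩
    rw [coboundary_cupCochain, hg]
    funext σ
    simp [cupCochain]

lemma cupCochain_mem_coboundaries_right {p q n : ℕ} (h : p + q = n) {f : Cochain R S p}
    {g : Cochain R S q} (hf : f ∈ cocycles R S p) (hg : g ∈ coboundaries R S q) :
    cupCochain h f g ∈ coboundaries R S n := by
  cases q with
  | zero =>
    obtain rfl : g = 0 := hg
    convert (coboundaries R S n).zero_mem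
    funext σ
    simp [cupCochain]
  | succ q =>
    obtain ⟨b, rfl⟩ := hg
    obtain ⟨n, rfl⟩ : ∃ k, n = k + 1 := ⟨p + q, by omega⟩
    rw [cocycles, LinearMap.mem_ker] at hf
    have key : coboundary R S n (cupCochain (by omega) f b) ∈ coboundaries R S (n + 1) :=
      ⟨_, rfl⟩
    rw [coboundary_cupCochain, hf] at key
    have := (coboundaries R S (n + 1)).smul_mem ((-1) ^ p : R) key
    convert this using 1
    funext σ
    simp [cupCochain, ← mul_assoc, ← pow_add, ← two_mul]

variable (R S)

/-- The cup product of cocycles, as a bilinear map. -/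
def cupCocycles {p q n : ℕ} (h : p + q = n) :
    cocycles R S p →ₗ[R] cocycles R S q →ₗ[R] cocycles R S n :=
  LinearMap.mk₂ R (fun f g => ⟨cupCochain h f.1 g.1, cupCochain_mem_cocycles h f.2 g.2⟩)
    (fun _ _ _ => Subtype.ext (funext fun _ => add_mul _ _ _))
    (fun _ _ _ => Subtype.ext (funext fun _ => mul_assoc _ _ _))
    (fun _ _ _ => Subtype.ext (funext fun _ => mul_add _ _ _))
    (fun _ _ _ => Subtype.ext (funext fun _ => mul_left_comm _ _ _))

/-- The cup product `Hᵖ × H^q → Hⁿ`, `p + q = n`, induced by the cup product of cocycles. -/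
def cup {p q n : ℕ} (h : p + q = n) :
    Cohomology R S p →ₗ[R] Cohomology R S q →ₗ[R] Cohomology R S n :=
  Submodule.liftQ _
    (LinearMap.flip (Submodule.liftQ _
      ((cupCocycles R S h).compr₂ (Submodule.mkQ _)).flip
      (fun g hg => by
        ext f
        exact (Submodule.Quotient.mk_eq_zero _).2
          (cupCochain_mem_coboundaries_right h f.2 hg))))
    (fun f hf => by
      ext g
      exact (Submodule.Quotient.mk_eq_zero _).2
        (cupCochain_mem_coboundaries_left h hf g.2))

lemma cup_mk {p q n : ℕ} (h : p + q = n) (f : cocycles R S p) (g : cocycles R S q) :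
    cup R S h (Submodule.Quotient.mk f) (Submodule.Quotient.mk g) =
      Submodule.Quotient.mk
        ⟨cupCochain h f.1 g.1, cupCochain_mem_cocycles h f.2 g.2⟩ := rfl

lemma one_mem_cocycles : (1 : Cochain R S 0) ∈ cocycles R S 0 := by
  rw [cocycles, LinearMap.mem_ker]
  funext σ
  simp [coboundary, Fin.sum_univ_two]

variable {R S}

/-- The `k`-th cup power `aᵏ ∈ H²ᵏ` of a class `a ∈ H²`; `a⁰` is the unit class `1 ∈ H⁰`. -/
def cupPow (a : Cohomology R S 2) : (k : ℕ) → Cohomology R S (2 * k)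
  | 0 => Submodule.Quotient.mk ⟨1, one_mem_cocycles R S⟩
  | k + 1 => cup R S (by omega) (cupPow a k) a

end SimplicialCohomology

/-- Singular cohomology `Hⁿ(X; R)` of a topological space. -/
abbrev SingularCohomology (R : Type) [CommRing R] (X : Type) [TopologicalSpace X] (n : ℕ) : Type :=
  SimplicialCohomology.Cohomology R (TopCat.toSSet.obj (TopCat.of X)) n

/-- A (closed smooth) manifold `X` of real dimension `2 * n` is cohomologically symplectic if
`aⁿ ≠ 0` in `H²ⁿ(X; ℚ)` for some `a ∈ H²(X; ℚ)`. -/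
def IsCSymplectic (n : ℕ) (X : Type) [TopologicalSpace X] : Prop :=
  ∃ a : SingularCohomology ℚ X 2, SimplicialCohomology.cupPow a n ≠ 0

/-! ## Characteristic maps and small covers -/

/-- A mod 2 characteristic map on an `n`-dimensional simple polytope with facets `F i`, `i : ι`:
facets with a common point have linearly independent vectors in `ℤ₂ⁿ`. -/
def IsCharacteristicMap {E ι : Type} {n : ℕ} (F : ι → Set E) (lam : ι → Fin n → ZMod 2) : Prop :=
  ∀ s : Set ι, (⋂ i ∈ s, F i).Nonempty → LinearIndepOn (ZMod 2) lam s

/-- The subgroup `G_{F(p)}` of `ℤ₂ⁿ` generated by the vectors of the facets that contain the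
point `p`, which are the facets that contain the face `F(p)` with `p` in its relative interior. -/
def facetSubgroup {E ι : Type} {n : ℕ} (F : ι → Set E) (lam : ι → Fin n → ZMod 2) (p : E) :
    AddSubgroup (Fin n → ZMod 2) :=
  AddSubgroup.closure (lam '' {i | p ∈ F i})

lemma zmod_two_add_self {n : ℕ} (g : Fin n → ZMod 2) : g + g = 0 :=
  funext fun i => CharTwo.add_self_eq_zero (g i)

/-- The relation `(g, p) ∼ (h, q)` iff `p = q` and `g + h ∈ G_{F(p)}` on `ℤ₂ⁿ × P`. -/
def smallCoverSetoid {E ι : Type} {n : ℕ} (P : Set E) (F : ι → Set E)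
    (lam : ι → Fin n → ZMod 2) : Setoid ((Fin n → ZMod 2) × P) where
  r x y := x.2 = y.2 ∧ x.1 + y.1 ∈ facetSubgroup F lam (x.2 : E)
  iseqv :=
    { refl := fun x => ⟨rfl, by
        rw [zmod_two_add_self]; exact zero_mem _⟩
      symm := by
        rintro ⟨g, p⟩ ⟨h, q⟩ ⟨h1, h2⟩
        obtain rfl : p = q := h1
        exact ⟨rfl, by rwa [add_comm]⟩
      trans := by
        rintro ⟨g, p⟩ ⟨h, q⟩ ⟨k, r⟩ ⟨h1, h2⟩ ⟨h3, h4⟩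
        obtain rfl : p = q := h1
        obtain rfl : p = r := h3
        refine ⟨rfl, ?_⟩
        have := add_mem h2 h4
        rwa [add_assoc, ← add_assoc h h k, zmod_two_add_self, zero_add] at this }

/-- The small cover `M(P, λ) = (ℤ₂ⁿ × P) / ∼` over a polytope `P` with facets `F i`, with the
quotient topology (`ℤ₂ⁿ` is discrete). -/
def SmallCover {E ι : Type} {n : ℕ} (P : Set E) (F : ι → Set E)
    (lam : ι → Fin n → ZMod 2) : Type :=
  Quotient (smallCoverSetoid P F lam)

instance {E ι : Type} [TopologicalSpace E] {n : ℕ} (P : Set E) (F : ι → Set E)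
    (lam : ι → Fin n → ZMod 2) : TopologicalSpace (SmallCover P F lam) :=
  inferInstanceAs (TopologicalSpace (Quotient (smallCoverSetoid P F lam)))

/-! ## Polygons and their products -/

/-- A convex `q`-gon in the plane, given by its vertices in counterclockwise order: all vertices
other than `v i` and `v (i + 1)` lie strictly to the left of the line from `v i` to `v (i + 1)`. -/
structure ConvexPolygon (q : ℕ) where
  three_le : 3 ≤ q
  vertex : ZMod q → ℝ × ℝ
  convex : ∀ i j : ZMod q, j ≠ i → j ≠ i + 1 →
    0 < ((vertex (i + 1)).1 - (vertex i).1) * ((vertex j).2 - (vertex i).2) -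
      ((vertex (i + 1)).2 - (vertex i).2) * ((vertex j).1 - (vertex i).1)

namespace ConvexPolygon

/-- The polygon as a subset of the plane. -/
def carrier {q : ℕ} (A : ConvexPolygon q) : Set (ℝ × ℝ) :=
  convexHull ℝ (Set.range A.vertex)

/-- The `i`-th edge, with endpoints `v i` and `v (i + 1)`; these are the facets. -/
def edge {q : ℕ} (A : ConvexPolygon q) (i : ZMod q) : Set (ℝ × ℝ) :=
  segment ℝ (A.vertex i) (A.vertex (i + 1))

/-- The product polytope `A × B` in `ℝ² × ℝ²`. -/
def prod {q r : ℕ} (A : ConvexPolygon q) (B : ConvexPolygon r) : Set ((ℝ × ℝ) × (ℝ × ℝ)) :=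
  A.carrier ×ˢ B.carrier

/-- The facets of `A × B`: products of an edge of one polygon with the other polygon. -/
def prodFacet {q r : ℕ} (A : ConvexPolygon q) (B : ConvexPolygon r) :
    ZMod q ⊕ ZMod r → Set ((ℝ × ℝ) × (ℝ × ℝ))
  | .inl i => A.edge i ×ˢ B.carrier
  | .inr j => A.carrier ×ˢ B.edge j

end ConvexPolygon

/-! Gluing copies of the triangle and of the `q`-gon, one copy for each choice of a sign per edge,
gives the sphere `S²` and a surface `Σ`, with one real coordinate per edge that vanishes exactly
over that edge. The sign group `ℤ₂^m` acts on `S² × Σ` by changing signs of coordinates, and the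
small cover is the quotient by the kernel of the homomorphism `ℤ₂^m → ℤ₂⁴` defined by `λ`.
Independence of the vectors at each point makes this kernel act freely
(`SignedSpace.isAddQuotientCoveringMap_projFun`), so by transfer (`isCob_of_pull_covering`) the
pullback to `S² × Σ` is injective on rational cohomology. It remains to see that the pullback `b` of
a class of degree two has `b² = 0`.

The vectors of the three edges of the triangle and of two adjacent edges of the polygon are five
vectors in `ℤ₂⁴`, hence dependent, while the four vectors at any vertex of the product are
independent. So the relation involves all three edges of the triangle (`exists_mem_deck`): some deck
transformation is antipodal on `S²`, hence acts by `-1` on `H²(S²)`, and it keeps every point of `Σ`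
in its path component (`joined_flip`). As `b` is invariant, its restriction to each sphere `S² ×
{z}` equals its own negative and vanishes (`isCob_pull_slice`).

The surface is covered by the open stars of the vertices of the polygon. Each star retracts to a
discrete set, so `b` vanishes over it. Consecutive stars meet in the star of an edge, which also
retracts to a discrete set; since `H¹(S²) = 0`, Mayer–Vietoris shows that `b` vanishes over the
union of all stars but one (`isCob_slab_chain`). Thus `b` vanishes on two open sets that cover `S² ×
Σ`, and `b²` vanishes by the relative cup product (`isCob_cup_of_cover`).

The topology is done with singular cochains, where `IsCob` says that a class of positive degree is
zero. Homotopy invariance and the theorem on small simplices are reduced to identities between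
formal tuples of vertices. -/

/-! ## Chains on tuples: cones, subdivision and prisms -/

namespace TupleChain

open Finsupp

variable {α β : Type}

/-- Rational chains on `(n + 1)`-tuples of elements of `α`. -/
abbrev Chain (α : Type) (n : ℕ) : Type := (Fin (n + 1) → α) →₀ ℚ

/-- The alternating sum of the faces of a tuple. -/
noncomputable def boundary (n : ℕ) : Chain α (n + 1) →ₗ[ℚ] Chain α n :=
  linearCombination ℚ fun v =>
    ∑ i : Fin (n + 2), (-1 : ℚ) ^ (i : ℕ) • single (v ∘ i.succAbove) (1 : ℚ)

/-- The cone with apex `b`. -/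
noncomputable def cone {n : ℕ} (b : α) : Chain α n →ₗ[ℚ] Chain α (n + 1) :=
  lmapDomain ℚ ℚ fun v => (Fin.cons b v : Fin (n + 2) → α)

/-- The map of chains induced by a map of vertices. -/
noncomputable def map {n : ℕ} (f : α → β) : Chain α n →ₗ[ℚ] Chain β n :=
  lmapDomain ℚ ℚ fun v => f ∘ v

lemma boundary_single {n : ℕ} (v : Fin (n + 2) → α) :
    boundary n (single v 1) =
      ∑ i : Fin (n + 2), (-1 : ℚ) ^ (i : ℕ) • single (v ∘ i.succAbove) (1 : ℚ) := by
  simp [boundary]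

lemma cone_single {n : ℕ} (b : α) (v : Fin (n + 1) → α) (a : ℚ) :
    cone b (single v a) = single (Fin.cons b v : Fin (n + 2) → α) a := by
  simp [cone]

lemma map_single {n : ℕ} (f : α → β) (v : Fin (n + 1) → α) (a : ℚ) :
    map f (single v a) = single (f ∘ v) a := by
  simp [map]

lemma cons_comp_succAbove_succ {n : ℕ} (b : α) (v : Fin (n + 2) → α) (i : Fin (n + 2)) :
    (Fin.cons b v : Fin (n + 3) → α) ∘ i.succ.succAbove =
      (Fin.cons b (v ∘ i.succAbove) : Fin (n + 2) → α) := by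
  funext j
  refine Fin.cases ?_ (fun j => ?_) j <;> simp

/-- Deleting the apex returns `c`; deleting any other vertex commutes with coning, with the sign
shifted by one place. The identities for `sd`, `sdHomotopy` and `prism` all come from this formula,
those operators being defined as cones. -/
lemma boundary_cone {n : ℕ} (b : α) (c : Chain α (n + 1)) :
    boundary (n + 1) (cone b c) = c - cone b (boundary n c) := by
  induction c using Finsupp.induction_linear with
  | zero => simp
  | add f g hf hg => rw [map_add, map_add, hf, hg, map_add, map_add]; abel
  | single v a =>
    rw [← mul_one a, ← smul_eq_mul, ← smul_single, map_smul, map_smul, map_smul, map_smul,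
      ← smul_sub, cone_single, boundary_single, boundary_single, Fin.sum_univ_succ, map_sum]
    congr 1
    simp only [map_smul, cone_single, cons_comp_succAbove_succ, Fin.val_succ, pow_succ]
    simp only [Fin.val_zero, pow_zero, one_smul, mul_neg, mul_one, neg_smul, Finset.sum_neg_distrib,
      ← sub_eq_add_neg]
    congr 2

/-- The augmentation. -/
noncomputable def augmentation : Chain α 0 →ₗ[ℚ] ℚ := linearCombination ℚ fun _ => 1

/-- A point has no boundary to cone over, so the augmentation takes the place of `∂c` in the lowest
degree. -/
lemma boundary_cone_zero (b : α) (c : Chain α 0) :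
    boundary 0 (cone b c) = c - augmentation c • single (fun _ => b) 1 := by
  induction c using Finsupp.induction_linear with
  | zero => simp
  | add f g hf hg => rw [map_add, map_add, hf, hg, map_add, add_smul]; abel
  | single v a =>
    rw [← mul_one a, ← smul_eq_mul, ← smul_single, map_smul, map_smul, map_smul, cone_single,
      boundary_single, Fin.sum_univ_two, smul_assoc, ← smul_sub]
    congr 1
    simp only [Fin.val_zero, pow_zero, one_smul, Fin.val_one, pow_one, neg_smul,
      ← sub_eq_add_neg, augmentation, linearCombination_single]
    congr 2
    funext j
    fin_cases j
    rfl

lemma augmentation_boundary (c : Chain α 1) : augmentation (boundary 0 c) = 0 := by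
  induction c using Finsupp.induction_linear with
  | zero => simp
  | add f g hf hg => rw [map_add, map_add, hf, hg, add_zero]
  | single v a => simp [boundary, augmentation, Fin.sum_univ_two]

lemma single_eq_cone {n : ℕ} (v : Fin (n + 2) → α) (a : ℚ) :
    single v a = cone (v 0) (single (Fin.tail v) a) := by
  rw [cone_single, Fin.cons_self_tail]

/-- Every tuple is the cone over its tail, so the cone formula reduces the claim to lower degree. -/
lemma boundary_boundary : ∀ {n : ℕ} (c : Chain α (n + 2)), boundary n (boundary (n + 1) c) = 0
  | n, c => by
    induction c using Finsupp.induction_linear with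
    | zero => simp
    | add f g hf hg => rw [map_add, map_add, hf, hg, add_zero]
    | single v a =>
      rw [single_eq_cone, boundary_cone, map_sub]
      cases n with
      | zero => rw [boundary_cone_zero, augmentation_boundary]; simp
      | succ n => rw [boundary_cone, boundary_boundary]; simp

lemma map_cone {n : ℕ} (f : α → β) (b : α) (c : Chain α n) :
    map f (cone b c) = cone (f b) (map f c) := by
  induction c using Finsupp.induction_linear with
  | zero => simp
  | add f g hf hg => simp only [map_add, hf, hg]
  | single v a => rw [cone_single, map_single, map_single, cone_single, Fin.comp_cons]

lemma map_boundary {n : ℕ} (f : α → β) (c : Chain α (n + 1)) :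
    map f (boundary n c) = boundary n (map f c) := by
  induction c using Finsupp.induction_linear with
  | zero => simp
  | add f g hf hg => simp only [map_add, hf, hg]
  | single v a =>
    simp [boundary, map, Function.comp_assoc]

lemma augmentation_map (f : α → β) (c : Chain α 0) :
    augmentation (map f c) = augmentation c := by
  induction c using Finsupp.induction_linear with
  | zero => simp
  | add f g hf hg => simp only [map_add, hf, hg]
  | single v a => simp [augmentation, map]

variable (bary : ∀ n : ℕ, (Fin (n + 1) → α) → α)

/-- Barycentric subdivision, for a choice of barycentres. -/
noncomputable def sd : (n : ℕ) → Chain α n →ₗ[ℚ] Chain α n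
  | 0 => LinearMap.id
  | n + 1 => linearCombination ℚ fun v => cone (bary (n + 1) v) (sd n (boundary n (single v 1)))

/-- The chain homotopy from the identity to subdivision. -/
noncomputable def sdHomotopy : (n : ℕ) → Chain α n →ₗ[ℚ] Chain α (n + 1)
  | 0 => 0
  | n + 1 => linearCombination ℚ fun v =>
      cone (bary (n + 1) v) (single v 1 - sdHomotopy n (boundary n (single v 1)))

lemma sd_single {n : ℕ} (v : Fin (n + 2) → α) :
    sd bary (n + 1) (single v 1) = cone (bary (n + 1) v) (sd bary n (boundary n (single v 1))) := by
  simp [sd]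

lemma sdHomotopy_single {n : ℕ} (v : Fin (n + 2) → α) :
    sdHomotopy bary (n + 1) (single v 1) =
      cone (bary (n + 1) v) (single v 1 - sdHomotopy bary n (boundary n (single v 1))) := by
  simp [sdHomotopy]

/-- Two linear maps that agree on tuples agree. -/
lemma linearMap_eq {ι M : Type} [AddCommGroup M] [Module ℚ M] (f g : (ι →₀ ℚ) →ₗ[ℚ] M)
    (h : ∀ v, f (single v 1) = g (single v 1)) (c : ι →₀ ℚ) : f c = g c := by
  have : f = g := by
    ext v
    simpa using h v
  rw [this]

lemma boundary_sd : ∀ {n : ℕ} (c : Chain α (n + 1)),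
    boundary n (sd bary (n + 1) c) = sd bary n (boundary n c)
  | n, c => by
    refine linearMap_eq (boundary n ∘ₗ sd bary (n + 1)) (sd bary n ∘ₗ boundary n) (fun v => ?_) c
    rw [LinearMap.comp_apply, LinearMap.comp_apply, sd_single]
    cases n with
    | zero =>
      rw [boundary_cone_zero]
      simp [sd, augmentation_boundary]
    | succ n => rw [boundary_cone, boundary_sd, boundary_boundary]; simp

lemma boundary_sdHomotopy : ∀ {n : ℕ} (c : Chain α (n + 1)),
    boundary (n + 1) (sdHomotopy bary (n + 1) c) =
      c - sd bary (n + 1) c - sdHomotopy bary n (boundary n c)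
  | n, c => by
    refine linearMap_eq (boundary (n + 1) ∘ₗ sdHomotopy bary (n + 1))
      (LinearMap.id - sd bary (n + 1) - sdHomotopy bary n ∘ₗ boundary n) (fun v => ?_) c
    simp only [LinearMap.comp_apply, LinearMap.sub_apply, LinearMap.id_apply]
    rw [sdHomotopy_single, sd_single, boundary_cone]
    -- By induction the chain under the cone has boundary `sd ∂v`, and coning that boundary from the
    -- barycentre gives exactly `sd v`.
    have key : boundary n (sdHomotopy bary n (boundary n (single v 1))) =
        boundary n (single v 1) - sd bary n (boundary n (single v 1)) := by
      cases n with
      | zero => simp [sdHomotopy, sd]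
      | succ n => rw [boundary_sdHomotopy, boundary_boundary]; simp
    rw [map_sub (boundary n), key]
    simp only [map_sub]
    abel

lemma map_sd (bary' : ∀ n : ℕ, (Fin (n + 1) → β) → β) (f : α → β)
    (hf : ∀ n v, f (bary n v) = bary' n (f ∘ v)) :
    ∀ {n : ℕ} (c : Chain α n), map f (sd bary n c) = sd bary' n (map f c)
  | 0, c => rfl
  | n + 1, c => by
    refine linearMap_eq (map f ∘ₗ sd bary (n + 1)) (sd bary' (n + 1) ∘ₗ map f) (fun v => ?_) c
    rw [LinearMap.comp_apply, LinearMap.comp_apply, sd_single, map_cone, map_single, sd_single, hf,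
      map_sd bary' f hf, map_boundary, map_single]

lemma map_sdHomotopy (bary' : ∀ n : ℕ, (Fin (n + 1) → β) → β) (f : α → β)
    (hf : ∀ n v, f (bary n v) = bary' n (f ∘ v)) :
    ∀ {n : ℕ} (c : Chain α n), map f (sdHomotopy bary n c) = sdHomotopy bary' n (map f c)
  | 0, c => by simp [sdHomotopy]
  | n + 1, c => by
    refine linearMap_eq (map f ∘ₗ sdHomotopy bary (n + 1)) (sdHomotopy bary' (n + 1) ∘ₗ map f)
      (fun v => ?_) c
    rw [LinearMap.comp_apply, LinearMap.comp_apply, sdHomotopy_single, map_cone, map_single,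
      sdHomotopy_single, hf, map_sub, map_sdHomotopy bary' f hf, map_boundary, map_single]

/-- The prism operator from chains on `α` to chains on two copies of `α`. -/
noncomputable def prism : (n : ℕ) → Chain α n →ₗ[ℚ] Chain (α × Bool) (n + 1)
  | 0 => linearCombination ℚ fun v =>
      cone (v 0, false) (map (·, true) (single v 1) - map (·, false) (single v 1))
  | n + 1 => linearCombination ℚ fun v =>
      cone (v 0, false) (map (·, true) (single v 1) - map (·, false) (single v 1) -
        prism n (boundary n (single v 1)))

lemma prism_single_zero (v : Fin 1 → α) :
    prism 0 (single v 1) =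
      cone (v 0, false) (map (·, true) (single v 1) - map (·, false) (single v 1)) := by
  simp [prism]

lemma prism_single {n : ℕ} (v : Fin (n + 2) → α) :
    prism (n + 1) (single v 1) =
      cone (v 0, false) (map (·, true) (single v 1) - map (·, false) (single v 1) -
        prism n (boundary n (single v 1))) := by
  simp [prism]

lemma boundary_prism_zero (c : Chain α 0) :
    boundary 0 (prism 0 c) = map (·, true) c - map (·, false) c := by
  refine linearMap_eq (boundary 0 ∘ₗ prism 0) (map (·, true) - map (·, false)) (fun v => ?_) c
  rw [LinearMap.comp_apply, prism_single_zero, boundary_cone_zero, map_sub, augmentation_map,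
    augmentation_map]
  simp

lemma boundary_prism : ∀ {n : ℕ} (c : Chain α (n + 1)),
    boundary (n + 1) (prism (n + 1) c) =
      map (·, true) c - map (·, false) c - prism n (boundary n c)
  | n, c => by
    refine linearMap_eq (boundary (n + 1) ∘ₗ prism (n + 1))
      (map (·, true) - map (·, false) - prism n ∘ₗ boundary n) (fun v => ?_) c
    simp only [LinearMap.comp_apply, LinearMap.sub_apply]
    rw [prism_single, boundary_cone]
    -- By this the chain under the cone (top minus bottom minus sides) is a cycle, so its cone
    -- bounds it.
    have key : boundary n (prism n (boundary n (single v 1))) =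
        map (·, true) (boundary n (single v 1)) - map (·, false) (boundary n (single v 1)) := by
      cases n with
      | zero => rw [boundary_prism_zero]
      | succ n => rw [boundary_prism, boundary_boundary]; simp
    rw [map_sub (boundary n), map_sub (boundary n), key, map_boundary, map_boundary]
    simp

lemma map_prism (f : α → β) : ∀ {n : ℕ} (c : Chain α n),
    map (Prod.map f id) (prism n c) = prism n (map f c)
  | 0, c => by
    refine linearMap_eq (map (Prod.map f id) ∘ₗ prism 0) (prism 0 ∘ₗ map f) (fun v => ?_) c
    rw [LinearMap.comp_apply, LinearMap.comp_apply, prism_single_zero, map_cone, map_single f,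
      prism_single_zero]
    simp only [map_sub, map_single]
    rfl
  | n + 1, c => by
    refine linearMap_eq (map (Prod.map f id) ∘ₗ prism (n + 1)) (prism (n + 1) ∘ₗ map f)
      (fun v => ?_) c
    rw [LinearMap.comp_apply, LinearMap.comp_apply, prism_single, map_cone, map_single f,
      prism_single, map_sub, map_prism, map_boundary]
    simp only [map_sub, map_single]
    rfl

end TupleChain

/-! ## Singular chains and cochains, and homotopy invariance -/

namespace SingularCochain

open Finsupp

/-- The standard simplex. -/
abbrev Spx (n : ℕ) : Set (Fin (n + 1) → ℝ) := stdSimplex ℝ (Fin (n + 1))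

/-- Singular simplices. -/
abbrev Sing (n : ℕ) (X : Type) [TopologicalSpace X] : Type := C(Spx n, X)

/-- Singular chains. -/
abbrev SChain (n : ℕ) (X : Type) [TopologicalSpace X] : Type := Sing n X →₀ ℚ

/-- Singular cochains. -/
abbrev Coch (n : ℕ) (X : Type) [TopologicalSpace X] : Type := Sing n X → ℚ

/-- The inclusion of the `i`-th face of the standard simplex. -/
noncomputable def face {n : ℕ} (i : Fin (n + 2)) : C(Spx n, Spx (n + 1)) :=
  ⟨stdSimplex.map i.succAbove, stdSimplex.continuous_map _⟩

/-! ### Affine simplices in convex sets. -/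

section AffineSimplex

variable {E : Type} [NormedAddCommGroup E] [NormedSpace ℝ E] {K : Set E} (hK : Convex ℝ K)

/-- The affine simplex with given vertices in a convex set. -/
noncomputable def affineSimplex {n : ℕ} (w : Fin (n + 1) → K) : C(Spx n, K) where
  toFun t := ⟨∑ i, t i • (w i : E), hK.sum_mem (fun i _ => t.2.1 i) t.2.2 fun i _ => (w i).2⟩
  continuous_toFun := by
    refine Continuous.subtype_mk (continuous_finsetSum _ fun i _ => ?_) _
    exact ((continuous_apply i).comp continuous_subtype_val).smul continuous_const

lemma affineSimplex_val {n : ℕ} (w : Fin (n + 1) → K) (t : Spx n) :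
    (affineSimplex hK w t : E) = ∑ i, t i • (w i : E) := rfl

lemma sum_map_smul {m n : ℕ} (f : Fin (m + 1) → Fin (n + 1)) (t : Spx m)
    (w : Fin (n + 1) → E) :
    ∑ j, stdSimplex.map f t j • w j = ∑ i, t i • w (f i) := by
  have h : ∀ j, stdSimplex.map f t j • w j = ∑ i with f i = j, t i • w (f i) := fun j => by
    rw [stdSimplex.map_coe, FunOnFinite.linearMap_apply_apply, Finset.sum_smul]
    exact Finset.sum_congr rfl fun i hi => by rw [(Finset.mem_filter.1 hi).2]
  simp only [h]
  exact Finset.sum_fiberwise _ _ _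

lemma affineSimplex_comp_face {n : ℕ} (w : Fin (n + 2) → K) (i : Fin (n + 2)) :
    (affineSimplex hK w).comp (face i) = affineSimplex hK (w ∘ i.succAbove) := by
  ext t
  exact sum_map_smul i.succAbove t fun j => (w j : E)

lemma affineSimplex_affineSimplex {m n : ℕ} (w : Fin (n + 1) → K) (v : Fin (m + 1) → Spx n)
    (t : Spx m) :
    affineSimplex hK w (affineSimplex (convex_stdSimplex ℝ _) v t) =
      affineSimplex hK (affineSimplex hK w ∘ v) t := by
  refine Subtype.ext ?_
  rw [affineSimplex_val, affineSimplex_val]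
  simp only [Function.comp_apply, affineSimplex_val, Finset.smul_sum, smul_smul]
  rw [Finset.sum_comm]
  refine Finset.sum_congr rfl fun i _ => ?_
  rw [← Finset.sum_smul]
  congr 1
  refine (congrFun (affineSimplex_val (convex_stdSimplex ℝ _) v t) i).trans ?_
  rw [Finset.sum_apply]
  rfl

/-- The barycentre of a tuple. -/
noncomputable def bary (n : ℕ) (w : Fin (n + 1) → K) : K :=
  affineSimplex hK w stdSimplex.barycenter

end AffineSimplex

/-- Affine simplices in the standard simplex. -/
noncomputable abbrev aff {m n : ℕ} (w : Fin (m + 1) → Spx n) : C(Spx m, Spx n) :=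
  affineSimplex (convex_stdSimplex ℝ _) w

/-- The vertices of the standard simplex. -/
noncomputable def vert (n : ℕ) (i : Fin (n + 1)) : Spx n := stdSimplex.vertex i

lemma aff_vert {m n : ℕ} (w : Fin (m + 1) → Spx n) : aff w ∘ vert m = w := by
  funext i
  refine Subtype.ext ?_
  rw [Function.comp_apply, affineSimplex_val]
  have h : ∀ j, vert m i j = if i = j then 1 else 0 := fun j => by
    simp [vert, Pi.single_apply, eq_comm]
  simp [h]

lemma aff_vert_eq_id (n : ℕ) : aff (vert n) = ContinuousMap.id _ := by
  ext t j
  refine (congrFun (affineSimplex_val (convex_stdSimplex ℝ _) (vert n) t) j).trans ?_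
  rw [Finset.sum_apply]
  have h : ∀ i, (vert n i).1 j = if i = j then 1 else 0 := fun i => by
    change vert n i j = _
    simp [vert, Pi.single_apply, eq_comm]
  simp only [Pi.smul_apply, h, smul_eq_mul, mul_ite, mul_one, mul_zero, Finset.sum_ite_eq',
    Finset.mem_univ, if_true]
  rfl

lemma face_eq_aff {n : ℕ} (i : Fin (n + 2)) : face i = aff (vert (n + 1) ∘ i.succAbove) := by
  rw [aff, ← affineSimplex_comp_face, ← aff, aff_vert_eq_id]
  rfl

lemma face_vert {n : ℕ} (i : Fin (n + 2)) : face i ∘ vert n = vert (n + 1) ∘ i.succAbove := by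
  rw [face_eq_aff, aff_vert]

/-! ### Singular chains and cochains as images of tuple chains. -/

variable {X Y Z : Type} [TopologicalSpace X] [TopologicalSpace Y] [TopologicalSpace Z]

/-- The boundary of singular chains. -/
noncomputable def bd (n : ℕ) : SChain (n + 1) X →ₗ[ℚ] SChain n X :=
  linearCombination ℚ fun σ =>
    ∑ i : Fin (n + 2), (-1 : ℚ) ^ (i : ℕ) • single (σ.comp (face i)) (1 : ℚ)

lemma bd_single {n : ℕ} (σ : Sing (n + 1) X) :
    bd n (single σ 1) =
      ∑ i : Fin (n + 2), (-1 : ℚ) ^ (i : ℕ) • single (σ.comp (face i)) (1 : ℚ) := by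
  simp [bd]

/-- The coboundary of singular cochains. -/
noncomputable def d (n : ℕ) : Coch n X →ₗ[ℚ] Coch (n + 1) X where
  toFun f σ := ∑ i : Fin (n + 2), (-1) ^ (i : ℕ) * f (σ.comp (face i))
  map_add' f g := by
    funext σ
    simp [mul_add, Finset.sum_add_distrib]
  map_smul' r f := by
    funext σ
    simp [Finset.mul_sum, mul_left_comm]

lemma d_apply {n : ℕ} (f : Coch n X) (σ : Sing (n + 1) X) :
    d n f σ = ∑ i : Fin (n + 2), (-1) ^ (i : ℕ) * f (σ.comp (face i)) := rfl

/-- Evaluation of cochains on chains. -/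
noncomputable def ev {n : ℕ} (f : Coch n X) : SChain n X →ₗ[ℚ] ℚ := linearCombination ℚ f

lemma ev_single {n : ℕ} (f : Coch n X) (σ : Sing n X) : ev f (single σ 1) = f σ := by
  simp [ev]

lemma ev_bd {n : ℕ} (f : Coch n X) (c : SChain (n + 1) X) : ev f (bd n c) = ev (d n f) c := by
  refine TupleChain.linearMap_eq (ev f ∘ₗ bd n) (ev (d n f)) (fun σ => ?_) c
  rw [LinearMap.comp_apply, bd_single, ev_single, d_apply, map_sum]
  simp [ev]

/-- Pullback of cochains. -/
def pull (f : C(X, Y)) {n : ℕ} : Coch n Y →ₗ[ℚ] Coch n X where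
  toFun y σ := y (f.comp σ)
  map_add' _ _ := rfl
  map_smul' _ _ := rfl

lemma pull_apply (f : C(X, Y)) {n : ℕ} (y : Coch n Y) (σ : Sing n X) :
    pull f y σ = y (f.comp σ) := rfl

lemma d_pull (f : C(X, Y)) {n : ℕ} (y : Coch n Y) : d n (pull f y) = pull f (d n y) := rfl

lemma pull_comp (f : C(X, Y)) (g : C(Y, Z)) {n : ℕ} (y : Coch n Z) :
    pull (g.comp f) y = pull f (pull g y) := rfl

/-- Push forward of tuple chains of a simplex to singular chains. -/
noncomputable def push {m n : ℕ} (σ : Sing n X) : TupleChain.Chain (Spx n) m →ₗ[ℚ] SChain m X :=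
  lmapDomain ℚ ℚ fun w => σ.comp (aff w)

lemma push_single {m n : ℕ} (σ : Sing n X) (w : Fin (m + 1) → Spx n) (a : ℚ) :
    push σ (single w a) = single (σ.comp (aff w)) a := by
  simp [push]

lemma bd_push {m n : ℕ} (σ : Sing n X) (c : TupleChain.Chain (Spx n) (m + 1)) :
    bd m (push σ c) = push σ (TupleChain.boundary m c) := by
  refine TupleChain.linearMap_eq (bd m ∘ₗ push σ) (push σ ∘ₗ TupleChain.boundary m)
    (fun w => ?_) c
  rw [LinearMap.comp_apply, LinearMap.comp_apply, push_single, bd_single,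
    TupleChain.boundary_single, map_sum]
  simp only [map_smul, push_single, ContinuousMap.comp_assoc, affineSimplex_comp_face]

lemma push_comp_aff {l m n : ℕ} (σ : Sing n X) (v : Fin (m + 1) → Spx n)
    (c : TupleChain.Chain (Spx m) l) :
    push (σ.comp (aff v)) c = push σ (TupleChain.map (aff v) c) := by
  refine TupleChain.linearMap_eq (push (σ.comp (aff v))) (push σ ∘ₗ TupleChain.map (aff v))
    (fun w => ?_) c
  rw [LinearMap.comp_apply, push_single, TupleChain.map_single, push_single]
  congr 1
  ext t
  exact congrArg σ (affineSimplex_affineSimplex _ v w t)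

/-- Every singular simplex is the image of the tautological tuple of vertices. Together with
`bd_push` this transfers identities from tuple chains to singular chains. -/
lemma single_eq_push {n : ℕ} (σ : Sing n X) : single σ (1 : ℚ) = push σ (single (vert n) 1) := by
  rw [push_single, aff_vert_eq_id]
  rfl

lemma bd_bd {n : ℕ} (c : SChain (n + 2) X) : bd n (bd (n + 1) c) = 0 := by
  refine TupleChain.linearMap_eq (bd n ∘ₗ bd (n + 1)) 0 (fun σ => ?_) c
  rw [LinearMap.comp_apply, single_eq_push, bd_push, bd_push, TupleChain.boundary_boundary,
    map_zero]
  rfl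

lemma d_d {n : ℕ} (f : Coch n X) : d (n + 1) (d n f) = 0 := by
  funext σ
  rw [← ev_single (d (n + 1) (d n f)), ← ev_bd, ← ev_bd, bd_bd, map_zero]
  rfl

/-- A cocycle. -/
def IsCocycle {n : ℕ} (y : Coch n X) : Prop := d n y = 0

/-- A coboundary in positive degree. -/
def IsCob {n : ℕ} (y : Coch (n + 1) X) : Prop := ∃ g, d n g = y

section Algebra

variable {n : ℕ}

lemma IsCocycle.pull {y : Coch n Y} (hy : IsCocycle y) (f : C(X, Y)) :
    IsCocycle (pull f y) := by
  rw [IsCocycle, d_pull, hy, map_zero]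

lemma IsCocycle.add {y z : Coch n X} (hy : IsCocycle y) (hz : IsCocycle z) :
    IsCocycle (y + z) := by
  rw [IsCocycle, map_add, hy, hz, add_zero]

lemma IsCocycle.sub {y z : Coch n X} (hy : IsCocycle y) (hz : IsCocycle z) :
    IsCocycle (y - z) := by
  rw [IsCocycle, map_sub, hy, hz, sub_zero]

lemma isCocycle_d (g : Coch n X) : IsCocycle (d n g) := d_d g

lemma IsCob.pull {y : Coch (n + 1) Y} (hy : IsCob y) (f : C(X, Y)) : IsCob (pull f y) := by
  obtain ⟨g, rfl⟩ := hy
  exact ⟨SingularCochain.pull f g, rfl⟩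

lemma IsCob.add {y z : Coch (n + 1) X} (hy : IsCob y) (hz : IsCob z) : IsCob (y + z) := by
  obtain ⟨g, rfl⟩ := hy
  obtain ⟨h, rfl⟩ := hz
  exact ⟨g + h, map_add _ _ _⟩

lemma IsCob.sub {y z : Coch (n + 1) X} (hy : IsCob y) (hz : IsCob z) : IsCob (y - z) := by
  obtain ⟨g, rfl⟩ := hy
  obtain ⟨h, rfl⟩ := hz
  exact ⟨g - h, map_sub _ _ _⟩

lemma IsCob.smul {y : Coch (n + 1) X} (hy : IsCob y) (r : ℚ) : IsCob (r • y) := by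
  obtain ⟨g, rfl⟩ := hy
  exact ⟨r • g, map_smul _ _ _⟩

end Algebra

/-! ### Homotopy invariance -/

/-- The affine simplex in a prism with given vertices. -/
noncomputable def affPrism {m n : ℕ} (w : Fin (m + 1) → Spx n × Bool) :
    C(Spx m, unitInterval × Spx n) :=
  (affineSimplex (convex_Icc (0 : ℝ) 1) fun i => (if (w i).2 then 1 else 0 : unitInterval)).prodMk
    (aff fun i => (w i).1)

lemma affPrism_comp_face {m n : ℕ} (w : Fin (m + 2) → Spx n × Bool) (i : Fin (m + 2)) :
    (affPrism w).comp (face i) = affPrism (w ∘ i.succAbove) := by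
  have h1 := affineSimplex_comp_face (convex_Icc (0 : ℝ) 1)
    (fun i => (if (w i).2 then 1 else 0 : unitInterval)) i
  have h2 := affineSimplex_comp_face (convex_stdSimplex ℝ _) (fun i => (w i).1) i
  ext t : 1
  exact Prod.ext (DFunLike.congr_fun h1 t) (DFunLike.congr_fun h2 t)

/-- Push forward of tuple chains of a prism. -/
noncomputable def pushPrism {m n : ℕ} (h : C(unitInterval × Spx n, X)) :
    TupleChain.Chain (Spx n × Bool) m →ₗ[ℚ] SChain m X :=
  lmapDomain ℚ ℚ fun w => h.comp (affPrism w)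

lemma pushPrism_single {m n : ℕ} (h : C(unitInterval × Spx n, X))
    (w : Fin (m + 1) → Spx n × Bool) (a : ℚ) :
    pushPrism h (single w a) = single (h.comp (affPrism w)) a := by
  simp [pushPrism]

lemma bd_pushPrism {m n : ℕ} (h : C(unitInterval × Spx n, X))
    (c : TupleChain.Chain (Spx n × Bool) (m + 1)) :
    bd m (pushPrism h c) = pushPrism h (TupleChain.boundary m c) := by
  refine TupleChain.linearMap_eq (bd m ∘ₗ pushPrism h) (pushPrism h ∘ₗ TupleChain.boundary m)
    (fun w => ?_) c
  rw [LinearMap.comp_apply, LinearMap.comp_apply, pushPrism_single, bd_single,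
    TupleChain.boundary_single, map_sum]
  simp only [map_smul, pushPrism_single, ContinuousMap.comp_assoc, affPrism_comp_face]

lemma pushPrism_map {l m n : ℕ} (h : C(unitInterval × Spx n, X)) (v : Fin (m + 1) → Spx n)
    (c : TupleChain.Chain (Spx m × Bool) l) :
    pushPrism h (TupleChain.map (Prod.map (aff v) id) c) =
      pushPrism (h.comp ((ContinuousMap.id _).prodMap (aff v))) c := by
  refine TupleChain.linearMap_eq (pushPrism h ∘ₗ TupleChain.map (Prod.map (aff v) id))
    (pushPrism (h.comp ((ContinuousMap.id _).prodMap (aff v)))) (fun w => ?_) c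
  rw [LinearMap.comp_apply, TupleChain.map_single, pushPrism_single, pushPrism_single]
  congr 1
  ext t
  refine congrArg h (Prod.ext rfl ?_)
  exact (affineSimplex_affineSimplex _ v (fun i => (w i).1) t).symm

lemma pushPrism_top {n : ℕ} (h : C(unitInterval × Spx n, X)) (b : Bool) :
    pushPrism h (TupleChain.map (·, b) (single (vert n) 1)) =
      single (h.comp ((ContinuousMap.const _ (if b then 1 else 0)).prodMk
        (ContinuousMap.id _))) 1 := by
  rw [TupleChain.map_single, pushPrism_single]
  congr 1
  ext t
  refine congrArg h (Prod.ext (Subtype.ext ?_) (DFunLike.congr_fun (aff_vert_eq_id n) t))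
  refine (affineSimplex_val _ _ t).trans ?_
  have : ∑ i, t i = 1 := stdSimplex.sum_eq_one t
  cases b <;> simp [this]

/-- Homotopic maps agree on cohomology. -/
theorem isCob_pull_sub_pull {f g : C(X, Y)} (F : f.Homotopy g) {n : ℕ} {y : Coch (n + 1) Y}
    (hy : IsCocycle y) : IsCob (pull g y - pull f y) := by
  let H : ∀ {m : ℕ}, Sing m X → C(unitInterval × Spx m, Y) := fun σ =>
    F.toContinuousMap.comp ((ContinuousMap.id _).prodMap σ)
  refine ⟨fun τ => ev y (pushPrism (H τ) (TupleChain.prism n (single (vert n) 1))), ?_⟩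
  funext σ
  -- A cocycle vanishes on the boundary of the prism over `σ`. The two ends contribute `g ∘ σ` and
  -- `f ∘ σ`, and the sides contribute the coboundary of the chosen primitive.
  have h0 : ev y (bd (n + 1) (pushPrism (H σ) (TupleChain.prism (n + 1)
      (single (vert (n + 1)) 1)))) = 0 := by
    rw [ev_bd, hy]
    simp [ev]
  rw [bd_pushPrism, TupleChain.boundary_prism, map_sub, map_sub, map_sub, map_sub, pushPrism_top,
    pushPrism_top, ev_single, ev_single, TupleChain.boundary_single, map_sum, map_sum, map_sum]
    at h0
  have h1 : (H σ).comp ((ContinuousMap.const _ (if true then 1 else 0)).prodMk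
      (ContinuousMap.id _)) = g.comp σ := by
    ext t
    exact F.apply_one (σ t)
  have h2 : (H σ).comp ((ContinuousMap.const _ (if false then 1 else 0)).prodMk
      (ContinuousMap.id _)) = f.comp σ := by
    ext t
    exact F.apply_zero (σ t)
  rw [h1, h2] at h0
  rw [d_apply, Pi.sub_apply, pull_apply, pull_apply, sub_eq_zero.1 h0]
  refine Finset.sum_congr rfl fun i _ => ?_
  rw [map_smul, map_smul, map_smul, smul_eq_mul, ← face_vert, ← TupleChain.map_single,
    ← TupleChain.map_prism, face_eq_aff, pushPrism_map]
  rfl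

end SingularCochain

/-! ## Small simplices and the Mayer–Vietoris argument -/

namespace SingularCochain

open Finsupp

/-! ### Barycentric subdivision shrinks simplices. -/

section Mesh

variable {E : Type} [NormedAddCommGroup E] [NormedSpace ℝ E] {K : Set E} (hK : Convex ℝ K)

/-- The barycentre minus `v i` is the mean of the `m + 1` differences `v j - v i`, one of which is
zero; hence the factor `m / (m + 1)`. -/
lemma dist_bary_le {m : ℕ} (v : Fin (m + 1) → K) {r : ℝ}
    (hv : ∀ i j, dist (v i : E) (v j) ≤ r) (i : Fin (m + 1)) :
    dist (v i : E) (bary hK m v) ≤ m / (m + 1) * r := by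
  have hm : (0 : ℝ) < m + 1 := by positivity
  have e : (bary hK m v : E) - v i = ((m : ℝ) + 1)⁻¹ • ∑ j, ((v j : E) - v i) := by
    rw [bary, affineSimplex_val, Finset.sum_sub_distrib, smul_sub, Finset.smul_sum]
    congr 1
    · refine Finset.sum_congr rfl fun j _ => ?_
      have hb : (stdSimplex.barycenter : Spx m) j = ((m : ℝ) + 1)⁻¹ := by
        refine (stdSimplex.barycenter_apply j).trans ?_
        rw [Fintype.card_fin, Nat.cast_add_one]
      rw [hb]
    · rw [Finset.sum_const, Finset.card_univ, Fintype.card_fin, ← Nat.cast_smul_eq_nsmul ℝ,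
        smul_smul]
      push_cast
      rw [inv_mul_cancel₀ hm.ne', one_smul]
  have hs : ‖∑ j, ((v j : E) - v i)‖ ≤ m * r := by
    rw [Fin.sum_univ_succAbove _ i, sub_self, zero_add]
    refine (norm_sum_le _ _).trans ((Finset.sum_le_card_nsmul _ _ r fun j _ => ?_).trans ?_)
    · rw [← dist_eq_norm]
      exact hv _ _
    · simp
  rw [dist_comm, dist_eq_norm, e, norm_smul, Real.norm_of_nonneg (by positivity)]
  calc ((m : ℝ) + 1)⁻¹ * ‖∑ j, ((v j : E) - v i)‖ ≤ ((m : ℝ) + 1)⁻¹ * (m * r) := by gcongr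
    _ = m / (m + 1) * r := by ring

/-- Tuples in the convex hull of `v` with distances at most `r`. -/
def meshSet (m : ℕ) {k : ℕ} (v : Fin (k + 1) → K) (r : ℝ) : Set (Fin (m + 1) → K) :=
  {w | (∀ i, (w i : E) ∈ convexHull ℝ (Set.range fun j => (v j : E))) ∧
    ∀ i j, dist (w i : E) (w j) ≤ r}

/-- A simplex of the subdivision is the barycentre joined to a simplex subdividing a face. Edges
inside the face are short by induction, as `m / (m + 1)` increases with `m`. Edges to the barycentre
are short because a ball around it that contains all vertices contains their hull; this is why
`meshSet` also records membership in the hull. -/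
lemma sd_single_mem : ∀ {m : ℕ} (v : Fin (m + 1) → K) {r : ℝ} (_ : 0 ≤ r)
    (_ : ∀ i j, dist (v i : E) (v j) ≤ r),
    TupleChain.sd (bary hK) m (single v 1) ∈
      supported ℚ ℚ (meshSet m v (m / (m + 1) * r))
  | 0, v, r, hr, hv => by
    refine single_mem_supported ℚ _ ⟨fun i => subset_convexHull ℝ _ ⟨i, rfl⟩, fun i j => ?_⟩
    rw [show i = j from Subsingleton.elim (α := Fin 1) i j]
    simp
  | m + 1, v, r, hr, hv => by
    rw [TupleChain.sd_single, TupleChain.boundary_single, map_sum, map_sum]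
    refine Submodule.sum_mem _ fun i _ => ?_
    rw [map_smul, map_smul]
    refine Submodule.smul_mem _ _ ?_
    have ih := sd_single_mem (v ∘ i.succAbove) hr fun j k => hv _ _
    have hmap : supported ℚ ℚ (meshSet m (v ∘ i.succAbove) (m / (m + 1) * r)) ≤
        (supported ℚ ℚ (meshSet (m + 1) v (((m + 1 : ℕ) : ℝ) / ((m + 1 : ℕ) + 1) * r))).comap
          (TupleChain.cone (bary hK (m + 1) v)) := by
      rw [supported_eq_span_single, Submodule.span_le]
      rintro _ ⟨w, ⟨hw1, hw2⟩, rfl⟩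
      rw [SetLike.mem_coe, Submodule.mem_comap, TupleChain.cone_single]
      have hc : ∀ j, (w j : E) ∈ convexHull ℝ (Set.range fun j => (v j : E)) := fun j =>
        convexHull_mono (by rintro _ ⟨k, rfl⟩; exact ⟨_, rfl⟩) (hw1 j)
      have hle : (m : ℝ) / (m + 1) * r ≤ ((m + 1 : ℕ) : ℝ) / ((m + 1 : ℕ) + 1) * r := by
        refine mul_le_mul_of_nonneg_right ?_ hr
        push_cast
        rw [div_le_div_iff₀ (by positivity) (by positivity)]
        nlinarith
      have hb : ∀ j, dist (w j : E) (bary hK (m + 1) v) ≤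
          ((m + 1 : ℕ) : ℝ) / ((m + 1 : ℕ) + 1) * r := fun j => by
        refine convexHull_min ?_ (convex_closedBall _ _) (hc j)
        rintro _ ⟨k, rfl⟩
        exact dist_bary_le hK v hv k
      refine single_mem_supported ℚ _ ⟨fun j => ?_, fun j k => ?_⟩
      · refine Fin.cases ?_ (fun j => ?_) j
        · rw [Fin.cons_zero, bary, affineSimplex_val]
          exact (convex_convexHull ℝ _).sum_mem (fun i _ => stdSimplex.zero_le _ i)
            (stdSimplex.sum_eq_one _) fun i _ => subset_convexHull ℝ _ ⟨i, rfl⟩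
        · exact hc j
      · refine Fin.cases ?_ (fun j => ?_) j <;> refine Fin.cases ?_ (fun k => ?_) k
        · rw [dist_self]
          positivity
        · rw [dist_comm]
          exact hb k
        · exact hb j
        · exact (hw2 j k).trans hle
    exact hmap ih

/-- Chains of tuples with distances at most `r`. -/
def meshChain (K : Set E) (m : ℕ) (r : ℝ) : Submodule ℚ (TupleChain.Chain K m) :=
  supported ℚ ℚ {w | ∀ i j, dist (w i : E) (w j) ≤ r}

lemma sd_mem_meshChain {m : ℕ} {r : ℝ} (hr : 0 ≤ r) {c : TupleChain.Chain K m}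
    (hc : c ∈ meshChain K m r) :
    TupleChain.sd (bary hK) m c ∈ meshChain K m (m / (m + 1) * r) := by
  have : meshChain K m r ≤ (meshChain K m (m / (m + 1) * r)).comap
      (TupleChain.sd (bary hK) m) := by
    rw [meshChain, supported_eq_span_single, Submodule.span_le]
    rintro _ ⟨w, hw, rfl⟩
    exact supported_mono (fun _ h => h.2) (sd_single_mem hK w hr hw)
  exact this hc

lemma iterate_sd_mem_meshChain {m : ℕ} {r : ℝ} (hr : 0 ≤ r) {c : TupleChain.Chain K m}
    (hc : c ∈ meshChain K m r) (k : ℕ) :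
    (TupleChain.sd (bary hK) m)^[k] c ∈ meshChain K m ((m / (m + 1) : ℝ) ^ k * r) := by
  induction k with
  | zero => simpa using hc
  | succ k ih =>
    rw [Function.iterate_succ_apply', pow_succ', mul_assoc]
    exact sd_mem_meshChain hK (by positivity) ih

end Mesh

/-! ### Subdivision of singular chains. -/

variable {X Y Z : Type} [TopologicalSpace X] [TopologicalSpace Y] [TopologicalSpace Z]

/-- The barycentre of a tuple of points of the standard simplex. -/
noncomputable abbrev sbary (n m : ℕ) : (Fin (m + 1) → Spx n) → Spx n :=
  bary (convex_stdSimplex ℝ _) m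

lemma aff_bary {m n k : ℕ} (v : Fin (m + 1) → Spx n) (w : Fin (k + 1) → Spx m) :
    aff v (sbary m k w) = sbary n k (aff v ∘ w) :=
  affineSimplex_affineSimplex _ _ _ _

/-- Subdivision of singular chains. -/
noncomputable def subdivide (n : ℕ) : SChain n X →ₗ[ℚ] SChain n X :=
  linearCombination ℚ fun σ => push σ (TupleChain.sd (sbary n) n (single (vert n) 1))

/-- The homotopy between the identity and subdivision. -/
noncomputable def subdivideHomotopy (n : ℕ) : SChain n X →ₗ[ℚ] SChain (n + 1) X :=
  linearCombination ℚ fun σ => push σ (TupleChain.sdHomotopy (sbary n) n (single (vert n) 1))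

lemma subdivide_single {n : ℕ} (σ : Sing n X) :
    subdivide n (single σ 1) = push σ (TupleChain.sd (sbary n) n (single (vert n) 1)) := by
  simp [subdivide]

lemma subdivideHomotopy_single {n : ℕ} (σ : Sing n X) :
    subdivideHomotopy n (single σ 1) =
      push σ (TupleChain.sdHomotopy (sbary n) n (single (vert n) 1)) := by
  simp [subdivideHomotopy]

lemma subdivide_push {m n : ℕ} (σ : Sing n X) (c : TupleChain.Chain (Spx n) m) :
    subdivide m (push σ c) = push σ (TupleChain.sd (sbary n) m c) := by
  refine TupleChain.linearMap_eq (subdivide m ∘ₗ push σ)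
    (push σ ∘ₗ TupleChain.sd (sbary n) m) (fun w => ?_) c
  rw [LinearMap.comp_apply, LinearMap.comp_apply, push_single, subdivide_single, push_comp_aff,
    TupleChain.map_sd _ (sbary n) _ fun k v => aff_bary w v, TupleChain.map_single, aff_vert]

lemma subdivideHomotopy_push {m n : ℕ} (σ : Sing n X) (c : TupleChain.Chain (Spx n) m) :
    subdivideHomotopy m (push σ c) = push σ (TupleChain.sdHomotopy (sbary n) m c) := by
  refine TupleChain.linearMap_eq (subdivideHomotopy m ∘ₗ push σ)
    (push σ ∘ₗ TupleChain.sdHomotopy (sbary n) m) (fun w => ?_) c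
  rw [LinearMap.comp_apply, LinearMap.comp_apply, push_single, subdivideHomotopy_single,
    push_comp_aff, TupleChain.map_sdHomotopy _ (sbary n) _ fun k v => aff_bary w v,
    TupleChain.map_single, aff_vert]

lemma bd_subdivide {n : ℕ} (c : SChain (n + 1) X) :
    bd n (subdivide (n + 1) c) = subdivide n (bd n c) := by
  refine TupleChain.linearMap_eq (bd n ∘ₗ subdivide (n + 1)) (subdivide n ∘ₗ bd n)
    (fun σ => ?_) c
  rw [LinearMap.comp_apply, LinearMap.comp_apply, subdivide_single, bd_push,
    TupleChain.boundary_sd, ← subdivide_push, ← bd_push, ← single_eq_push]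

lemma bd_subdivideHomotopy {n : ℕ} (c : SChain (n + 1) X) :
    bd (n + 1) (subdivideHomotopy (n + 1) c) =
      c - subdivide (n + 1) c - subdivideHomotopy n (bd n c) := by
  refine TupleChain.linearMap_eq (bd (n + 1) ∘ₗ subdivideHomotopy (n + 1))
    (LinearMap.id - subdivide (n + 1) - subdivideHomotopy n ∘ₗ bd n) (fun σ => ?_) c
  simp only [LinearMap.comp_apply, LinearMap.sub_apply, LinearMap.id_apply]
  rw [subdivideHomotopy_single, bd_push, TupleChain.boundary_sdHomotopy, map_sub, map_sub,
    ← single_eq_push, ← subdivideHomotopy_push, ← bd_push, ← single_eq_push, ← subdivide_single]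

/-- Chains of simplices each contained in `U` or in `V`. -/
def smallChain (n : ℕ) (U V : Set X) : Submodule ℚ (SChain n X) :=
  supported ℚ ℚ {σ | (∀ t, σ t ∈ U) ∨ ∀ t, σ t ∈ V}

lemma push_mem_smallChain {m n : ℕ} {U V : Set X} {σ : Sing n X}
    (hσ : (∀ t, σ t ∈ U) ∨ ∀ t, σ t ∈ V) (c : TupleChain.Chain (Spx n) m) :
    push σ c ∈ smallChain m U V := by
  induction c using Finsupp.induction_linear with
  | zero => simp
  | add f g hf hg =>
    rw [map_add]
    exact add_mem hf hg
  | single w a =>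
    rw [push_single]
    exact single_mem_supported ℚ _ (hσ.imp (fun h t => h _) (fun h t => h _))

lemma subdivide_mem_smallChain {n : ℕ} {U V : Set X} {c : SChain n X}
    (hc : c ∈ smallChain n U V) : subdivide n c ∈ smallChain n U V := by
  have : smallChain n U V ≤ (smallChain n U V).comap (subdivide n) := by
    rw [smallChain, supported_eq_span_single, Submodule.span_le]
    rintro _ ⟨σ, hσ, rfl⟩
    rw [SetLike.mem_coe, Submodule.mem_comap, subdivide_single, ← supported_eq_span_single]
    exact push_mem_smallChain hσ _
  exact this hc

lemma iterate_subdivide_push {m n : ℕ} (σ : Sing n X) (c : TupleChain.Chain (Spx n) m) (k : ℕ) :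
    (subdivide m)^[k] (push σ c) = push σ ((TupleChain.sd (sbary n) m)^[k] c) := by
  induction k with
  | zero => rfl
  | succ k ih => rw [Function.iterate_succ_apply', ih, subdivide_push, Function.iterate_succ_apply']

/-- The preimages of `U` and `V` cover the compact standard simplex; subdivision is iterated until
the mesh is below a Lebesgue number of this cover. -/
lemma exists_iterate_single_small {n : ℕ} {U V : Set X} (hU : IsOpen U) (hV : IsOpen V)
    (hUV : U ∪ V = Set.univ) (σ : Sing n X) :
    ∃ k, (subdivide n)^[k] (single σ 1) ∈ smallChain n U V := by
  obtain ⟨δ, hδ, hball⟩ := lebesgue_number_lemma_of_metric (s := (Set.univ : Set (Spx n)))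
    (c := fun b : Bool => σ ⁻¹' (if b then U else V)) isCompact_univ
    (fun b => by cases b <;> simp [hU.preimage σ.continuous, hV.preimage σ.continuous])
    (fun t _ => by
      rcases (hUV.symm ▸ Set.mem_univ (σ t) : σ t ∈ U ∪ V) with h | h
      · exact Set.mem_iUnion.2 ⟨true, h⟩
      · exact Set.mem_iUnion.2 ⟨false, h⟩)
  obtain ⟨k, hk⟩ := exists_pow_lt_of_lt_one hδ
    (show (n : ℝ) / (n + 1) < 1 by rw [div_lt_one (by positivity)]; linarith)
  refine ⟨k, ?_⟩
  have h1 : single (vert n) (1 : ℚ) ∈ meshChain (Spx n) n 1 := by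
    refine single_mem_supported ℚ _ fun i j => ?_
    exact (Metric.dist_le_diam_of_mem (bounded_stdSimplex _) (vert n i).2 (vert n j).2).trans
      diam_stdSimplex_le
  have h2 := iterate_sd_mem_meshChain (convex_stdSimplex ℝ _) zero_le_one h1 k
  rw [single_eq_push, iterate_subdivide_push]
  have : meshChain (Spx n) n ((n / (n + 1) : ℝ) ^ k * 1) ≤
      (smallChain n U V).comap (push σ) := by
    rw [meshChain, supported_eq_span_single, Submodule.span_le]
    rintro _ ⟨w, hw, rfl⟩
    rw [SetLike.mem_coe, Submodule.mem_comap, push_single]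
    obtain ⟨b, hb⟩ := hball (w 0) trivial
    -- The closed ball around the first vertex is convex and contains the other vertices, hence the
    -- whole affine simplex.
    have hin : ∀ t, σ (aff w t) ∈ (if b then U else V) := fun t => hb <| by
      change dist (aff w t : Fin (n + 1) → ℝ) (w 0) < δ
      refine lt_of_le_of_lt ?_ ((mul_one _).trans_lt hk)
      exact (convex_closedBall ((w 0 : Spx n) : Fin (n + 1) → ℝ) _).sum_mem
        (fun i _ => t.2.1 i) t.2.2 fun i _ => hw i 0
    refine single_mem_supported ℚ _ ?_
    cases b
    · exact Or.inr hin
    · exact Or.inl hin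
  exact this h2

/-- Asking for smallness at all later stages, not only at stage `k`, makes the property pass to sums
of chains. -/
lemma exists_iterate_small {n : ℕ} {U V : Set X} (hU : IsOpen U) (hV : IsOpen V)
    (hUV : U ∪ V = Set.univ) (c : SChain n X) :
    ∃ k, ∀ l, k ≤ l → (subdivide n)^[l] c ∈ smallChain n U V := by
  have hstable : ∀ (c : SChain n X) (k : ℕ), (subdivide n)^[k] c ∈ smallChain n U V →
      ∀ l, k ≤ l → (subdivide n)^[l] c ∈ smallChain n U V := fun c k h l hl => by
    induction l, hl using Nat.le_induction with
    | base => exact h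
    | succ l _ ih =>
      rw [Function.iterate_succ_apply']
      exact subdivide_mem_smallChain ih
  induction c using Finsupp.induction_linear with
  | zero =>
    refine ⟨0, fun l _ => ?_⟩
    rw [iterate_map_zero]
    exact zero_mem _
  | add f g hf hg =>
    obtain ⟨k, hk⟩ := hf
    obtain ⟨k', hk'⟩ := hg
    refine ⟨max k k', fun l hl => ?_⟩
    rw [iterate_map_add]
    exact add_mem (hk l (le_trans (le_max_left _ _) hl)) (hk' l (le_trans (le_max_right _ _) hl))
  | single σ a =>
    obtain ⟨k, hk⟩ := exists_iterate_single_small hU hV hUV σ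
    refine ⟨k, fun l hl => ?_⟩
    rw [← mul_one a, ← smul_eq_mul, ← smul_single, ← Module.End.pow_apply, map_smul,
      Module.End.pow_apply]
    exact Submodule.smul_mem _ _ (hstable _ k hk l hl)

/-- A cocycle that vanishes on small simplices is a coboundary. -/
theorem isCob_of_small {n : ℕ} {U V : Set X} (hU : IsOpen U) (hV : IsOpen V)
    (hUV : U ∪ V = Set.univ) {y : Coch (n + 1) X} (hy : IsCocycle y)
    (hyU : ∀ σ : Sing (n + 1) X, (∀ t, σ t ∈ U) → y σ = 0)
    (hyV : ∀ σ : Sing (n + 1) X, (∀ t, σ t ∈ V) → y σ = 0) : IsCob y := by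
  have hsmall : ∀ c ∈ smallChain (n + 1) U V, ev y c = 0 := fun c hc => by
    have : smallChain (n + 1) U V ≤ LinearMap.ker (ev y) := by
      rw [smallChain, supported_eq_span_single, Submodule.span_le]
      rintro _ ⟨σ, hσ, rfl⟩
      rw [SetLike.mem_coe, LinearMap.mem_ker, ev_single]
      exact hσ.elim (hyU σ) (hyV σ)
    exact this hc
  -- On cycles the subdivision homotopy shows that subdividing does not change the value of the
  -- cocycle `y`.
  have hsub : ∀ c : SChain (n + 1) X, bd n c = 0 → ∀ k, ev y ((subdivide (n + 1))^[k] c) = ev y c ∧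
      bd n ((subdivide (n + 1))^[k] c) = 0 := fun c hc k => by
    induction k with
    | zero => exact ⟨rfl, hc⟩
    | succ k ih =>
      rw [Function.iterate_succ_apply']
      set c' := (subdivide (n + 1))^[k] c
      refine ⟨?_, by rw [bd_subdivide, ih.2, map_zero]⟩
      have h := congrArg (ev y) (bd_subdivideHomotopy c')
      rw [ev_bd, hy, ih.2, map_zero, sub_zero, map_sub, ih.1] at h
      have h0 : ev (0 : Coch (n + 2) X) (subdivideHomotopy (n + 1) c') = 0 := by simp [ev]
      linarith
  have hker : LinearMap.ker (bd (X := X) n) ≤ LinearMap.ker (ev y) := fun c hc => by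
    obtain ⟨k, hk⟩ := exists_iterate_small hU hV hUV c
    rw [LinearMap.mem_ker, ← (hsub c hc k).1]
    exact hsmall _ (hk k le_rfl)
  -- Over a field, a functional that kills the cycles factors through the boundary map; the factor
  -- `g` is the primitive.
  obtain ⟨g, hg⟩ : ev y ∈ LinearMap.range (bd (X := X) n).dualMap := by
    rw [LinearMap.range_dualMap_eq_dualAnnihilator_ker, Submodule.mem_dualAnnihilator]
    exact fun c hc => hker hc
  refine ⟨fun σ => g (single σ 1), funext fun σ => ?_⟩
  rw [← ev_single y, ← hg, LinearMap.dualMap_apply, bd_single, map_sum, d_apply]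
  exact Finset.sum_congr rfl fun i _ => (map_smul g _ _).symm

/-! ### Subspaces -/

/-- The inclusion of a subspace. -/
def val (A : Set X) : C(A, X) := ⟨Subtype.val, continuous_subtype_val⟩

/-- The inclusion of subspaces. -/
def incl {A B : Set X} (h : A ⊆ B) : C(A, B) := ⟨Set.inclusion h, continuous_inclusion h⟩

/-- Corestriction of a map to a subspace. -/
def cores (A : Set X) (f : C(Y, X)) (h : ∀ t, f t ∈ A) : C(Y, A) :=
  ⟨fun t => ⟨f t, h t⟩, f.continuous.subtype_mk h⟩

/-- Primitives that agree on the overlap glue to a cochain `η`, set to zero on simplices lying in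
neither set. Then `y - dη` vanishes on small simplices and `isCob_of_small` applies. -/
theorem isCob_union_of_eq {n : ℕ} {A B : Set X} (hA : IsOpen A) (hB : IsOpen B)
    {y : Coch (n + 1) ↥(A ∪ B)} (hy : IsCocycle y) {α : Coch n A} {β : Coch n B}
    (hα : d n α = pull (incl Set.subset_union_left) y)
    (hβ : d n β = pull (incl Set.subset_union_right) y)
    (hαβ : pull (incl (Set.inter_subset_left (s := A) (t := B))) α =
      pull (incl (Set.inter_subset_right (s := A) (t := B))) β) :
    IsCob y := by
  classical
  let η : Coch n ↥(A ∪ B) := fun σ =>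
    if h : ∀ t, (σ t : X) ∈ A then α (cores A ((val _).comp σ) h)
    else if h : ∀ t, (σ t : X) ∈ B then β (cores B ((val _).comp σ) h) else 0
  have ηA : ∀ σ : Sing n ↥(A ∪ B), ∀ h : ∀ t, (σ t : X) ∈ A,
      η σ = α (cores A ((val _).comp σ) h) := fun σ h => dif_pos h
  have ηB : ∀ σ : Sing n ↥(A ∪ B), ∀ h : ∀ t, (σ t : X) ∈ B,
      η σ = β (cores B ((val _).comp σ) h) := fun σ h => by
    by_cases h' : ∀ t, (σ t : X) ∈ A
    · rw [ηA σ h']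
      exact congrFun hαβ (cores (A ∩ B) ((val _).comp σ) fun t => ⟨h' t, h t⟩)
    · exact (dif_neg h').trans (dif_pos h)
  have hc : IsCob (y - d n η) := by
    refine isCob_of_small (hA.preimage continuous_subtype_val)
      (hB.preimage continuous_subtype_val) ?_ (hy.sub (isCocycle_d η)) ?_ ?_
    · ext x
      exact iff_of_true x.2 trivial
    · intro σ h
      have e := congrFun hα (cores A ((val _).comp σ) h)
      rw [Pi.sub_apply, sub_eq_zero]
      refine e.symm.trans ?_
      rw [d_apply, d_apply]
      exact Finset.sum_congr rfl fun i _ => by rw [ηA _ fun t => h _]; rfl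
    · intro σ h
      have e := congrFun hβ (cores B ((val _).comp σ) h)
      rw [Pi.sub_apply, sub_eq_zero]
      refine e.symm.trans ?_
      rw [d_apply, d_apply]
      exact Finset.sum_congr rfl fun i _ => by rw [ηB _ fun t => h _]; rfl
  simpa using hc.add ⟨η, rfl⟩

/-- Cochains on a subspace extend. -/
lemma exists_pull_incl_eq {n : ℕ} {A B : Set X} (h : A ⊆ B) (γ : Coch n A) :
    ∃ γ' : Coch n B, pull (incl h) γ' = γ := by
  classical
  refine ⟨fun σ => if h' : ∀ t, (σ t : X) ∈ A then γ (cores A ((val _).comp σ) h') else 0, ?_⟩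
  funext σ
  exact dif_pos fun t => (σ t).2

/-- The primitives differ on the overlap by some `dγ`. Extending `γ` to a cochain on `A` and
subtracting its coboundary from `α` makes them agree there. -/
theorem isCob_union {n : ℕ} {A B : Set X} (hA : IsOpen A) (hB : IsOpen B)
    {y : Coch (n + 2) X} (hy : IsCocycle y) {α : Coch (n + 1) A} {β : Coch (n + 1) B}
    (hα : d _ α = pull (val A) y) (hβ : d _ β = pull (val B) y)
    (hαβ : IsCob (pull (incl (Set.inter_subset_left (s := A) (t := B))) α -
      pull (incl (Set.inter_subset_right (s := A) (t := B))) β)) :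
    IsCob (pull (val (A ∪ B)) y) := by
  obtain ⟨γ, hγ⟩ := hαβ
  obtain ⟨γ', rfl⟩ := exists_pull_incl_eq (Set.inter_subset_left (s := A) (t := B)) γ
  refine isCob_union_of_eq hA hB (hy.pull _) (α := α - d _ γ') (β := β) ?_ hβ ?_
  · rw [map_sub, d_d, sub_zero, hα]
    rfl
  · rw [map_sub, ← d_pull, hγ, sub_sub_cancel]

lemma isCob_of_val_univ {n : ℕ} {y : Coch (n + 1) X} {A : Set X} (hA : A = Set.univ)
    (h : IsCob (pull (val A) y)) : IsCob y := by
  subst hA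
  exact h.pull (cores Set.univ (ContinuousMap.id X) fun _ => trivial)

/-- If the cohomology of `A ∩ B` vanishes in degree `n + 1`, then a class in degree `n + 2` that
vanishes on `A` and on `B` vanishes on `A ∪ B`. -/
theorem isCob_union_of_inter {n : ℕ} {A B : Set X} (hA : IsOpen A) (hB : IsOpen B)
    (hAB : ∀ c : Coch (n + 1) ↥(A ∩ B), IsCocycle c → IsCob c)
    {y : Coch (n + 2) X} (hy : IsCocycle y) (hyA : IsCob (pull (val A) y))
    (hyB : IsCob (pull (val B) y)) : IsCob (pull (val (A ∪ B)) y) := by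
  obtain ⟨α, hα⟩ := hyA
  obtain ⟨β, hβ⟩ := hyB
  refine isCob_union hA hB hy hα hβ (hAB _ ?_)
  rw [IsCocycle, map_sub, d_pull, d_pull, hα, hβ, ← pull_comp, ← pull_comp]
  exact sub_self _

/-! ### Locally constant maps -/

/-- A map that is locally one of several maps that kill a class kills the class. -/
theorem isCob_pull_of_locallyConstant {n : ℕ} {I : Type} {y : Coch (n + 1) X} (f : C(Y, X))
    {c : Y → I} (hc : IsLocallyConstant c) (g : I → C(Y, X)) (hg : ∀ t, f t = g (c t) t)
    (hy : ∀ i, IsCob (pull (g i) y)) : IsCob (pull f y) := by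
  choose β hβ using hy
  have hconst : ∀ {m : ℕ} (σ : Sing m Y) (s t : Spx m), c (σ s) = c (σ t) := fun σ s t =>
    (hc.comp_continuous σ.continuous).apply_eq_of_isPreconnected isPreconnected_univ
      trivial trivial
  -- A simplex is connected, so `c` is constant along it and its value at any vertex selects the
  -- right primitive.
  refine ⟨fun σ => β (c (σ (vert n 0))) σ, funext fun σ => ?_⟩
  have h1 : f.comp σ = (g (c (σ (vert (n + 1) 0)))).comp σ := by
    ext t
    exact (hg (σ t)).trans (by rw [hconst σ t (vert (n + 1) 0)]; rfl)
  rw [pull_apply, h1, ← pull_apply (g _) y, ← hβ, d_apply, d_apply]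
  refine Finset.sum_congr rfl fun i _ => ?_
  rw [show c ((σ.comp (face i)) (vert n 0)) = c (σ (vert (n + 1) 0)) from hconst σ _ _]

end SingularCochain

/-! ## Cup products and transfer -/

namespace SingularCochain

open CategoryTheory

variable {X Y Z : Type} [TopologicalSpace X] [TopologicalSpace Y] [TopologicalSpace Z]

/-- The map of standard simplices induced by `i ↦ i + j`. -/
noncomputable def shiftFace {n : ℕ} (j l : ℕ) (h : j + l ≤ n) : C(Spx l, Spx n) :=
  ⟨stdSimplex.map fun i : Fin (l + 1) => (⟨i + j, by omega⟩ : Fin (n + 1)),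
    stdSimplex.continuous_map _⟩

/-- The Alexander–Whitney product of singular cochains. -/
noncomputable def cup {p q n : ℕ} (h : p + q = n) (a : Coch p X) (b : Coch q X) : Coch n X :=
  fun σ => a (σ.comp (shiftFace 0 p (by omega))) * b (σ.comp (shiftFace p q (by omega)))

/-- The simplices of the singular simplicial set. -/
noncomputable def simplexEquiv (X : Type) [TopologicalSpace X] (n : ℕ) :
    SimplicialCohomology.Simplex (TopCat.toSSet.obj (TopCat.of X)) n ≃ Sing n X :=
  TopCat.toSSetObjEquiv (TopCat.of X) (Opposite.op (SimplexCategory.mk n))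

/-- A singular cochain as a cochain of the singular simplicial set. -/
noncomputable def toCochain {n : ℕ} :
    Coch n X ≃ₗ[ℚ] SimplicialCohomology.Cochain ℚ (TopCat.toSSet.obj (TopCat.of X)) n :=
  LinearEquiv.funCongrLeft ℚ ℚ (simplexEquiv X n)

lemma coboundary_toCochain {n : ℕ} (a : Coch n X) :
    SimplicialCohomology.coboundary ℚ _ n (toCochain a) = toCochain (d n a) := rfl

lemma cupCochain_toCochain {p q n : ℕ} (h : p + q = n) (a : Coch p X) (b : Coch q X) :
    SimplicialCohomology.cupCochain h (toCochain a) (toCochain b) = toCochain (cup h a b) := rfl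

lemma toCochain_mem_cocycles {n : ℕ} {a : Coch n X} :
    toCochain a ∈ SimplicialCohomology.cocycles ℚ (TopCat.toSSet.obj (TopCat.of X)) n ↔
      IsCocycle a := by
  rw [SimplicialCohomology.cocycles, LinearMap.mem_ker, coboundary_toCochain,
    LinearEquiv.map_eq_zero_iff]
  rfl

lemma toCochain_mem_coboundaries {n : ℕ} {a : Coch (n + 1) X} :
    toCochain a ∈ SimplicialCohomology.coboundaries ℚ (TopCat.toSSet.obj (TopCat.of X)) (n + 1) ↔
      IsCob a := by
  constructor
  · rintro ⟨g, hg⟩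
    refine ⟨toCochain.symm g, toCochain.injective ?_⟩
    rw [← coboundary_toCochain, LinearEquiv.apply_symm_apply, hg]
  · rintro ⟨g, rfl⟩
    exact ⟨toCochain g, rfl⟩

lemma IsCocycle.cup {p q n : ℕ} (h : p + q = n) {a : Coch p X} {b : Coch q X}
    (ha : IsCocycle a) (hb : IsCocycle b) : IsCocycle (cup h a b) :=
  toCochain_mem_cocycles.1 (SimplicialCohomology.cupCochain_mem_cocycles h
    (toCochain_mem_cocycles.2 ha) (toCochain_mem_cocycles.2 hb))

lemma IsCob.cup_left {p q n : ℕ} (h : p + 1 + q = n + 1) {a : Coch (p + 1) X} {b : Coch q X}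
    (ha : IsCob a) (hb : IsCocycle b) : IsCob (SingularCochain.cup h a b) :=
  toCochain_mem_coboundaries.1 (SimplicialCohomology.cupCochain_mem_coboundaries_left h
    (toCochain_mem_coboundaries.2 ha) (toCochain_mem_cocycles.2 hb))

lemma IsCob.cup_right {p q n : ℕ} (h : p + (q + 1) = n + 1) {a : Coch p X} {b : Coch (q + 1) X}
    (ha : IsCocycle a) (hb : IsCob b) : IsCob (SingularCochain.cup h a b) :=
  toCochain_mem_coboundaries.1 (SimplicialCohomology.cupCochain_mem_coboundaries_right h
    (toCochain_mem_cocycles.2 ha) (toCochain_mem_coboundaries.2 hb))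

/-- Extending a primitive from `A` by zero replaces `a` by a cohomologous cochain that vanishes
identically on simplices in `A`: a lift to relative cohomology. -/
lemma exists_sub_vanish {n : ℕ} {A : Set X} {a : Coch (n + 1) X} (ha : IsCob (pull (val A) a)) :
    ∃ α : Coch n X, ∀ σ : Sing (n + 1) X, (∀ t, σ t ∈ A) → (a - d n α) σ = 0 := by
  classical
  obtain ⟨α, hα⟩ := ha
  refine ⟨fun σ => if h' : ∀ t, σ t ∈ A then α (cores A σ h') else 0, fun σ hσ => ?_⟩
  rw [Pi.sub_apply, sub_eq_zero]
  refine (congrFun hα (cores A σ hσ)).symm.trans ?_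
  rw [d_apply, d_apply]
  refine Finset.sum_congr rfl fun i _ => ?_
  rw [dif_pos (show ∀ t, (σ.comp (face i)) t ∈ A from fun t => hσ _)]
  rfl

/-- If `a` vanishes on `U` and `b` vanishes on `V`, then `a ∪ b` vanishes on `U ∪ V`. -/
theorem isCob_cup_of_cover {p q n : ℕ} (h : p + 1 + (q + 1) = n + 1) {U V : Set X}
    (hU : IsOpen U) (hV : IsOpen V) (hUV : U ∪ V = Set.univ) {a : Coch (p + 1) X}
    {b : Coch (q + 1) X} (ha : IsCocycle a) (hb : IsCocycle b) (haU : IsCob (pull (val U) a))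
    (hbV : IsCob (pull (val V) b)) : IsCob (cup h a b) := by
  obtain ⟨α, hα⟩ := exists_sub_vanish haU
  obtain ⟨β, hβ⟩ := exists_sub_vanish hbV
  have ha' : IsCocycle (a - d p α) := ha.sub (isCocycle_d _)
  have hb' : IsCocycle (b - d q β) := hb.sub (isCocycle_d _)
  -- The product of the corrected cocycles is zero on each simplex in `U`, through the front face,
  -- and on each simplex in `V`, through the back face.
  have h1 : IsCob (cup h (a - d p α) (b - d q β)) := by
    refine isCob_of_small hU hV hUV (ha'.cup h hb') (fun σ hσ => ?_) (fun σ hσ => ?_)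
    · exact mul_eq_zero_of_left (hα _ fun t => hσ _) _
    · exact mul_eq_zero_of_right _ (hβ _ fun t => hσ _)
  have h2 : IsCob (cup h (a - d p α) (d q β)) := IsCob.cup_right h ha' ⟨_, rfl⟩
  have h3 : IsCob (cup h (d p α) b) := IsCob.cup_left h ⟨_, rfl⟩ hb
  convert (h1.add h2).add h3 using 1
  funext σ
  simp only [cup, Pi.sub_apply, Pi.add_apply]
  ring

/-! ### Transfer -/

instance (n : ℕ) : ContractibleSpace (Spx n) :=
  (convex_stdSimplex ℝ _).contractibleSpace ⟨_, (vert n 0).2⟩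

instance (n : ℕ) : LocallyPathConnectedSpace (Spx n) :=
  (convex_stdSimplex ℝ _).locallyPathConnectedSpace

/-- The pullback along a finite quotient covering is injective on rational cohomology. -/
theorem isCob_of_pull_covering {G : Type} [AddGroup G] [Finite G] [AddAction G Z] {π : C(Z, X)}
    (hπ : IsAddQuotientCoveringMap π G) {n : ℕ} {y : Coch (n + 1) X} (hy : IsCob (pull π y)) :
    IsCob y := by
  classical
  have := Fintype.ofFinite G
  have := hπ.toContinuousConstVAdd
  obtain ⟨f, hf⟩ := hy
  let T : G → C(Z, Z) := fun g => ⟨fun z => g +ᵥ z, continuous_const_vadd g⟩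
  have hT : ∀ g, π.comp (T g) = π := fun g => by
    ext z
    exact hπ.map_vadd g
  have hlift : ∀ {m : ℕ} (σ : Sing m X), ∃ σ' : Sing m Z, π.comp σ' = σ := fun {m} σ => by
    obtain ⟨e, he⟩ := hπ.surjective (σ (vert m 0))
    obtain ⟨F, ⟨-, hF⟩, -⟩ := hπ.isCoveringMap.existsUnique_continuousMap_lifts σ (vert m 0) e he
    exact ⟨F, DFunLike.coe_injective hF⟩
  -- The transfer: summing over the deck translates of a lift. Two lifts of a simplex differ by a
  -- deck transformation, so the sum depends only on the simplex below.
  let S : ∀ {m : ℕ}, Coch m Z → Sing m Z → ℚ := fun f σ => ∑ g : G, f ((T g).comp σ)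
  have hS : ∀ {m : ℕ} (f : Coch m Z) (σ σ' : Sing m Z), π.comp σ = π.comp σ' → S f σ = S f σ' := by
    intro m f σ σ' h
    obtain ⟨g, hg⟩ := hπ.apply_eq_iff_mem_orbit.1 (DFunLike.congr_fun h (vert m 0))
    have e : σ = (T g).comp σ' := by
      obtain ⟨F, -, hF⟩ := hπ.isCoveringMap.existsUnique_continuousMap_lifts (π.comp σ)
        (vert m 0) (σ (vert m 0)) rfl
      refine (hF _ ⟨rfl, rfl⟩).trans (hF _ ⟨hg, ?_⟩).symm
      rw [h]
      exact congrArg DFunLike.coe (congrArg (fun f : C(Z, X) => f.comp σ') (hT g))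
    rw [e]
    refine Fintype.sum_equiv (Equiv.addRight g) _ _ fun k => ?_
    congr 1
    ext t
    exact (add_vadd k g (σ' t)).symm
  choose L hL using @hlift
  have hd : d n (fun σ => S f (L σ)) = (Fintype.card G : ℚ) • y := by
    funext σ
    have h1 : ∀ i, S f (L (σ.comp (face i))) = S f ((L σ).comp (face i)) := fun i =>
      hS f _ _ ((hL _).trans (by rw [← ContinuousMap.comp_assoc, hL]))
    rw [d_apply]
    simp only [h1, S, Finset.mul_sum]
    rw [Finset.sum_comm]
    have h2 : ∀ g : G, ∑ i : Fin (n + 2), (-1 : ℚ) ^ (i : ℕ) *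
        f ((T g).comp ((L σ).comp (face i))) = y σ := fun g => by
      refine (congrFun hf ((T g).comp (L σ))).trans ?_
      rw [pull_apply, ← ContinuousMap.comp_assoc, hT, hL]
    simp [h2]
  -- Rational coefficients enter here: the transferred primitive bounds `|G| • y`.
  have hcard : (Fintype.card G : ℚ) ≠ 0 := Nat.cast_ne_zero.2 Fintype.card_ne_zero
  refine ⟨(Fintype.card G : ℚ)⁻¹ • fun σ => S f (L σ), ?_⟩
  rw [map_smul, hd, smul_smul, inv_mul_cancel₀ hcard, one_smul]

/-- A space is not cohomologically symplectic in dimension four if squares of rational classes of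
degree two vanish. -/
theorem not_isCSymplectic_two
    (h : ∀ a : Coch 2 X, IsCocycle a → IsCob (cup (n := 4) rfl a a)) : ¬ IsCSymplectic 2 X := by
  rintro ⟨a, ha⟩
  obtain ⟨⟨f, hf⟩, rfl⟩ := Submodule.Quotient.mk_surjective _ a
  obtain ⟨f, rfl⟩ := toCochain.surjective f
  refine ha ((Submodule.Quotient.mk_eq_zero _).2 ?_)
  have h2 := toCochain_mem_coboundaries.2 (h f (toCochain_mem_cocycles.1 hf))
  rw [Submodule.submoduleOf, Submodule.mem_comap]
  -- The second cup power unfolds to `(1 ∪ a) ∪ a`; the unit is removed already at the level of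
  -- cochains.
  have e1 : SimplicialCohomology.cupCochain (n := 2) rfl 1 (toCochain f) = toCochain f := by
    funext σ
    refine (one_mul _).trans (congrArg (toCochain f) ?_)
    have : SimplexCategory.subinterval 0 2 (le_refl 2) = 𝟙 _ := by
      ext x
      rfl
    rw [SimplicialCohomology.intervalFace, this]
    simp
  rw [← cupCochain_toCochain, ← e1] at h2
  nth_rewrite 2 [e1] at h2
  exact h2

end SingularCochain

/-! ## Points, paths and reflections -/

namespace SingularCochain

variable {X Y Z : Type} [TopologicalSpace X] [TopologicalSpace Y] [TopologicalSpace Z]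

/-- Constant maps kill cohomology in positive degrees. -/
lemma isCob_pull_const {n : ℕ} {y : Coch (n + 1) X} (hy : IsCocycle y) (x : X) :
    IsCob (pull (ContinuousMap.const Y x) y) := by
  have hpow := Fin.sum_neg_one_pow ℚ
  refine IsCob.pull (f := ContinuousMap.const Y ()) (y := pull (ContinuousMap.const Unit x) y) ?_
  have hc := hy.pull (ContinuousMap.const Unit x)
  set z := pull (ContinuousMap.const Unit x) y
  have hz : ∀ (σ τ : Sing (n + 1) Unit), z σ = z τ := fun σ τ => congrArg z (by ext)
  -- On a point a coboundary is an alternating sum of equal values, equal to that value when the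
  -- number of faces is odd. For `n` even, the cocycle condition has `n + 3` terms and gives `z =
  -- 0`; for `n` odd, the constant cochain, with `n + 2` faces, is a primitive.
  rcases Nat.even_or_odd n with hn | hn
  · refine ⟨0, ?_⟩
    rw [map_zero]
    funext σ
    have h := congrFun hc (ContinuousMap.const _ ())
    rw [d_apply] at h
    simp only [hz _ σ, ← Finset.sum_mul, hpow] at h
    rw [if_neg (by rw [Nat.not_even_iff_odd]; exact hn.add_odd (by decide : Odd 3))] at h
    simpa using h.symm
  · refine ⟨fun _ => z (ContinuousMap.const _ ()), funext fun σ => ?_⟩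
    rw [d_apply]
    simp only [hz _ σ, ← Finset.sum_mul, hpow]
    rw [if_neg (by rw [Nat.not_even_iff_odd]; exact hn.add_even (by decide : Even 2)), one_mul]

/-- The simplex at a point. -/
def ptSimplex (x : X) : Sing 0 X := ContinuousMap.const _ x

lemma eq_ptSimplex (σ : Sing 0 X) : σ = ptSimplex (σ (vert 0 0)) := by
  ext t
  exact congrArg σ (Subsingleton.elim (α := stdSimplex ℝ (Fin 1)) _ _)

/-- Cocycles of degree zero are constant along paths. -/
lemma IsCocycle.eq_of_joined {c : Coch 0 X} (hc : IsCocycle c) {x y : X} (h : Joined x y) :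
    c (ptSimplex x) = c (ptSimplex y) := by
  obtain ⟨γ⟩ := h
  let σ : Sing 1 X := γ.toContinuousMap.comp
    ⟨stdSimplexHomeomorphUnitInterval, stdSimplexHomeomorphUnitInterval.continuous⟩
  have h := congrFun hc σ
  rw [d_apply, Fin.sum_univ_two] at h
  have e : ∀ i : Fin 2, face i (vert 0 0) = vert 1 (i.succAbove 0) := fun i =>
    congrFun (face_vert (n := 0) i) 0
  have h0 : σ.comp (face 0) = ptSimplex y := by
    rw [eq_ptSimplex (σ.comp (face 0))]
    congr 1
    change σ (face 0 (vert 0 0)) = y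
    rw [e]
    exact (congrArg γ stdSimplexHomeomorphUnitInterval_one).trans γ.target
  have h1 : σ.comp (face 1) = ptSimplex x := by
    rw [eq_ptSimplex (σ.comp (face 1))]
    congr 1
    change σ (face 1 (vert 0 0)) = x
    rw [e]
    exact (congrArg γ stdSimplexHomeomorphUnitInterval_zero).trans γ.source
  rw [h0, h1] at h
  simp only [Fin.val_zero, pow_zero, one_mul, Fin.val_one, pow_one, Pi.zero_apply] at h
  linarith

/-- A union of two open sets that are acyclic in degree one, with connected intersection, is
acyclic in degree one. -/
lemma isCob_union_of_pathConnected {A B : Set X} (hA : IsOpen A) (hB : IsOpen B)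
    [PathConnectedSpace ↥(A ∩ B)] {y : Coch 1 X} (hy : IsCocycle y) (hyA : IsCob (pull (val A) y))
    (hyB : IsCob (pull (val B) y)) : IsCob (pull (val (A ∪ B)) y) := by
  obtain ⟨α, hα⟩ := hyA
  obtain ⟨β, hβ⟩ := hyB
  let x₀ : ↥(A ∩ B) := Classical.arbitrary _
  set γ := pull (incl (Set.inter_subset_left (s := A) (t := B))) α -
    pull (incl (Set.inter_subset_right (s := A) (t := B))) β with hγ
  have hγc : IsCocycle γ := by
    rw [IsCocycle, map_sub, d_pull, d_pull, hα, hβ, ← pull_comp, ← pull_comp]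
    exact sub_self _
  -- The primitives differ by a constant on the path-connected overlap, so shifting `α` by it makes
  -- them agree.
  have hconst : ∀ σ, γ σ = γ (ptSimplex x₀) := fun σ => by
    rw [eq_ptSimplex σ]
    exact hγc.eq_of_joined (PathConnectedSpace.joined _ _)
  refine isCob_union_of_eq hA hB (hy.pull _) (α := α - fun _ => γ (ptSimplex x₀)) (β := β) ?_ hβ ?_
  · rw [map_sub, hα, ← pull_comp]
    refine sub_eq_self.2 ?_
    funext σ
    simp [d_apply, Fin.sum_univ_two]
  · rw [map_sub, sub_eq_iff_eq_add, ← sub_eq_iff_eq_add', ← hγ]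
    funext σ
    exact hconst σ

/-- A reflection acts by `-1` if it exchanges two open sets on which classes vanish, and acts
trivially on the cohomology of their intersection. -/
theorem isCob_add_pull_of_swap {n : ℕ} {s : C(X, X)} (hs : ∀ x, s (s x) = x) {U : Set X}
    (hU : IsOpen U) (hUs : U ∪ s ⁻¹' U = Set.univ)
    (hvan : ∀ y : Coch (n + 2) X, IsCocycle y → IsCob (pull (val U) y))
    (htriv : ∀ c : Coch (n + 1) ↥(U ∩ s ⁻¹' U), IsCocycle c →
      IsCob (c - pull (cores (U ∩ s ⁻¹' U) (s.comp (val _)) fun x =>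
        ⟨x.2.2, by simpa [val, hs] using x.2.1⟩) c))
    {y : Coch (n + 2) X} (hy : IsCocycle y) : IsCob (y + pull s y) := by
  obtain ⟨α, hα⟩ := hvan y hy
  obtain ⟨α', hα'⟩ := hvan _ (hy.pull s)
  let sUV : C(U, ↥(s ⁻¹' U)) := cores _ (s.comp (val U)) fun x => by
    change s (s x) ∈ U
    rw [hs]
    exact x.2
  let sVU : C(↥(s ⁻¹' U), U) := cores _ (s.comp (val _)) fun x => x.2
  let β := pull sVU α'
  have hβ : d _ β = pull (val (s ⁻¹' U)) y := by
    rw [d_pull, hα', ← pull_comp, ← pull_comp]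
    exact congrArg (fun f : C(↥(s ⁻¹' U), X) => pull f y) (ContinuousMap.ext fun x => hs x)
  -- Here `α` and `β` are primitives of `y` on `U` and on `s⁻¹ U`, so `α + s*β` and `β + s*α` are
  -- primitives of `y + s*y` there. On the overlap they differ by `c - s*c` for the cocycle `c = α -
  -- β`, which `htriv` makes a coboundary.
  refine isCob_of_val_univ hUs (isCob_union hU (hU.preimage s.continuous)
    (α := α + pull sUV β) (β := β + pull sVU α) (hy.add (hy.pull s)) ?_ ?_ ?_)
  · rw [map_add, d_pull, hα, hβ, map_add]
    rfl
  · rw [map_add, hβ, d_pull, hα, map_add]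
    rfl
  · set i₁ := incl (Set.inter_subset_left (s := U) (t := s ⁻¹' U))
    set i₂ := incl (Set.inter_subset_right (s := U) (t := s ⁻¹' U))
    have hc : IsCocycle (pull i₁ α - pull i₂ β) := by
      rw [IsCocycle, map_sub, d_pull, d_pull, hα, hβ, ← pull_comp, ← pull_comp]
      exact sub_self _
    convert htriv _ hc using 1
    rw [map_add, map_add, map_sub]
    simp only [← pull_comp]
    rw [← sub_eq_zero]
    have e1 : sUV.comp i₁ = i₂.comp (cores (U ∩ s ⁻¹' U) (s.comp (val _)) fun x =>
      ⟨x.2.2, by simpa [val, hs] using x.2.1⟩) := rfl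
    have e2 : sVU.comp i₂ = i₁.comp (cores (U ∩ s ⁻¹' U) (s.comp (val _)) fun x =>
      ⟨x.2.2, by simpa [val, hs] using x.2.1⟩) := rfl
    rw [e1, e2]
    abel

end SingularCochain

/-! ## Sign changes and the two-sphere -/

/-- The sign of a residue mod two. -/
def bitSign (a : ZMod 2) : ℝ := if a = 0 then 1 else -1

lemma bitSign_zero : bitSign 0 = 1 := if_pos rfl

lemma bitSign_add : ∀ a b : ZMod 2, bitSign (a + b) = bitSign a * bitSign b := by
  have h : ∀ a : ZMod 2, a = 0 ∨ a = 1 := by decide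
  intro a b
  rcases h a with rfl | rfl <;> rcases h b with rfl | rfl <;>
    simp [bitSign, show (1 : ZMod 2) + 1 = 0 from rfl]

lemma bitSign_mul_self (a : ZMod 2) : bitSign a * bitSign a = 1 := by
  rw [← bitSign_add, CharTwo.add_self_eq_zero, bitSign_zero]

lemma bitSign_sq (a : ZMod 2) : bitSign a ^ 2 = 1 := by rw [sq, bitSign_mul_self]

lemma bitSign_one : bitSign 1 = -1 := if_neg (by decide)

/-- The unit sphere in three-space. -/
def unitSphere : Set (ZMod 3 → ℝ) := {x | ∑ i, x i ^ 2 = 1}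

namespace unitSphere

open SingularCochain

lemma sum_sq_pos {x : ZMod 3 → ℝ} (hx : x ≠ 0) : 0 < ∑ i, x i ^ 2 := by
  obtain ⟨i, hi⟩ := Function.ne_iff.1 hx
  exact Finset.sum_pos' (fun j _ => sq_nonneg _) ⟨i, Finset.mem_univ i, sq_pos_of_ne_zero hi⟩

/-- Radial projection of a nonvanishing map. -/
noncomputable def normalize {A : Type} [TopologicalSpace A] (h : C(A, ZMod 3 → ℝ))
    (h0 : ∀ a, h a ≠ 0) : C(A, unitSphere) where
  toFun a := ⟨fun i => h a i / √(∑ j, h a j ^ 2), by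
    change ∑ i, (h a i / √(∑ j, h a j ^ 2)) ^ 2 = 1
    have := sum_sq_pos (h0 a)
    simp only [div_pow, ← Finset.sum_div, Real.sq_sqrt this.le]
    exact div_self this.ne'⟩
  continuous_toFun := by
    refine Continuous.subtype_mk (continuous_pi fun i => ?_) _
    refine Continuous.div (by fun_prop) (by fun_prop) fun a => ?_
    exact (Real.sqrt_pos.2 (sum_sq_pos (h0 a))).ne'

lemma normalize_apply {A : Type} [TopologicalSpace A] (h : C(A, ZMod 3 → ℝ))
    (h0 : ∀ a, h a ≠ 0) (a : A) (i : ZMod 3) :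
    (normalize h h0 a).1 i = h a i / √(∑ j, h a j ^ 2) := rfl

lemma normalize_eq {A : Type} [TopologicalSpace A] (h : C(A, ZMod 3 → ℝ))
    (h0 : ∀ a, h a ≠ 0) (a : A) (x : unitSphere) (hx : h a = x) : normalize h h0 a = x := by
  refine Subtype.ext (funext fun i => ?_)
  rw [normalize_apply, hx, show ∑ j, x.1 j ^ 2 = 1 from x.2, Real.sqrt_one, div_one]

/-- A change of signs of the coordinates. -/
noncomputable def flip (g : ZMod 3 → ZMod 2) : C(unitSphere, unitSphere) where
  toFun x := ⟨fun i => bitSign (g i) * x.1 i, by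
    change ∑ i, (bitSign (g i) * x.1 i) ^ 2 = 1
    simp only [mul_pow, bitSign_sq, one_mul]
    exact x.2⟩
  continuous_toFun := by
    refine Continuous.subtype_mk (continuous_pi fun i => ?_) _
    exact continuous_const.mul ((continuous_apply i).comp continuous_subtype_val)

lemma flip_apply (g : ZMod 3 → ZMod 2) (x : unitSphere) (i : ZMod 3) :
    (flip g x).1 i = bitSign (g i) * x.1 i := rfl

lemma flip_add (g h : ZMod 3 → ZMod 2) : flip (g + h) = (flip g).comp (flip h) := by
  ext x i
  change bitSign (g i + h i) * x.1 i = bitSign (g i) * (bitSign (h i) * x.1 i)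
  rw [bitSign_add, mul_assoc]

lemma flip_zero : flip 0 = ContinuousMap.id _ := by
  ext x i
  change bitSign 0 * x.1 i = x.1 i
  rw [bitSign_zero, one_mul]

/-- The sphere without the point where the `i`-th coordinate is `-1`. -/
def cap (i : ZMod 3) : Set unitSphere := {x | x.1 i ≠ -1}

lemma isOpen_cap (i : ZMod 3) : IsOpen (cap i) :=
  isOpen_ne_fun ((continuous_apply i).comp continuous_subtype_val) continuous_const

/-- The point where the `i`-th coordinate is `1`. -/
noncomputable def pole (i : ZMod 3) : unitSphere :=
  ⟨Pi.single i 1, by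
    change ∑ j, (Pi.single i 1 : ZMod 3 → ℝ) j ^ 2 = 1
    rw [Finset.sum_eq_single i] <;> simp +contextual⟩

lemma eq_zero_of_sq_eq_one {x : unitSphere} {i : ZMod 3} (h : x.1 i ^ 2 = 1) {j : ZMod 3}
    (hj : j ≠ i) : x.1 j = 0 := by
  have h1 : ∑ k, x.1 k ^ 2 = 1 := x.2
  rw [← Finset.add_sum_erase _ _ (Finset.mem_univ i), h, add_eq_left,
    Finset.sum_eq_zero_iff_of_nonneg fun _ _ => sq_nonneg _] at h1
  exact pow_eq_zero_iff two_ne_zero |>.1 (h1 j (Finset.mem_erase.2 ⟨hj, Finset.mem_univ j⟩))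

lemma sq_eq_one_of_forall {x : unitSphere} {i : ZMod 3} (h : ∀ j, j ≠ i → x.1 j = 0) :
    x.1 i ^ 2 = 1 := by
  have h1 : ∑ k, x.1 k ^ 2 = 1 := x.2
  rwa [Finset.sum_eq_single i (fun j _ hj => by rw [h j hj]; simp) (by simp)] at h1

/-- The cap contracts to its pole inside the sphere. -/
noncomputable def capContract (i : ZMod 3) :
    (val (cap i)).Homotopy (ContinuousMap.const _ (pole i)) where
  toContinuousMap := normalize
    ⟨fun p : unitInterval × cap i => (1 - (p.1 : ℝ)) • (p.2.1.1 : ZMod 3 → ℝ) +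
      (p.1 : ℝ) • Pi.single i 1, by fun_prop⟩ <| by
      -- The segment from `x` to the pole meets the origin only if `x` is the opposite pole, which
      -- the cap omits.
      rintro ⟨t, x, hx⟩ h
      have hj : ∀ j, j ≠ i → (1 - (t : ℝ)) * x.1 j = 0 := fun j hj => by
        simpa [hj] using congrFun h j
      have hi : (1 - (t : ℝ)) * x.1 i + t = 0 := by simpa using congrFun h i
      by_cases ht : 1 - (t : ℝ) = 0
      · rw [ht] at hi
        linarith
      · have := sq_eq_one_of_forall (x := x) (i := i) fun j h =>
          (mul_eq_zero.1 (hj j h)).resolve_left ht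
        rcases sq_eq_one_iff.1 this with h1 | h1
        · rw [h1] at hi
          linarith
        · exact hx h1
  map_zero_left x := normalize_eq _ _ _ _ (by simp [val])
  map_one_left x := normalize_eq _ _ _ _ (by simp [pole])

lemma isCob_cap (i : ZMod 3) {n : ℕ} {y : Coch (n + 1) unitSphere} (hy : IsCocycle y) :
    IsCob (pull (val (cap i)) y) := by
  have := (isCob_pull_const hy (pole i)).sub (isCob_pull_sub_pull (capContract i) hy)
  simpa using this

lemma preimage_cap (i : ZMod 3) : flip (Pi.single i 1) ⁻¹' cap i = {x | x.1 i ≠ 1} := by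
  ext x
  change bitSign ((Pi.single i 1 : ZMod 3 → ZMod 2) i) * x.1 i ≠ -1 ↔ x.1 i ≠ 1
  rw [Pi.single_eq_same, bitSign_one, neg_one_mul, Ne, neg_inj]

lemma cap_union (i : ZMod 3) : cap i ∪ flip (Pi.single i 1) ⁻¹' cap i = Set.univ := by
  rw [preimage_cap]
  refine Set.eq_univ_of_forall fun x => ?_
  by_cases h : x.1 i = 1
  · left
    change x.1 i ≠ -1
    rw [h]
    norm_num
  · exact Or.inr h

lemma flip_flip (g : ZMod 3 → ZMod 2) (x : unitSphere) : flip g (flip g x) = x := by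
  have := DFunLike.congr_fun (flip_add g g) x
  rw [show g + g = 0 from funext fun i => CharTwo.add_self_eq_zero (g i), flip_zero] at this
  exact this.symm

end unitSphere

/-! ### Products of reflections. -/

namespace SingularCochain

variable {X : Type} [TopologicalSpace X]

/-- If every coordinate reflection acts by `-1`, then so does every element with an odd number of
reflections. -/
lemma isCob_add_pull_of_odd {ι : Type} [Fintype ι] [DecidableEq ι] {n : ℕ}
    {F : (ι → ZMod 2) → C(X, X)} (h0 : F 0 = ContinuousMap.id X)
    (hadd : ∀ g h, F (g + h) = (F g).comp (F h))
    (hF : ∀ i, ∀ y : Coch (n + 1) X, IsCocycle y → IsCob (y + pull (F (Pi.single i 1)) y))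
    {g : ι → ZMod 2} (hg : ∑ i, g i = 1) {y : Coch (n + 1) X} (hy : IsCocycle y) :
    IsCob (y + pull (F g) y) := by
  -- Each reflection contributes a factor `-1`, so the product over `s` acts by `(-1)^|s|`.
  have key : ∀ s : Finset ι,
      IsCob (pull (F (∑ i ∈ s, Pi.single i 1)) y - (-1 : ℚ) ^ s.card • y) := fun s => by
    induction s using Finset.induction_on with
    | empty =>
      rw [Finset.sum_empty, h0, Finset.card_empty, pow_zero, one_smul]
      exact ⟨0, by rw [map_zero]; exact (sub_self y).symm⟩
    | insert i s hi ih =>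
      rw [Finset.sum_insert hi, add_comm (Pi.single i 1), hadd, Finset.card_insert_of_notMem hi]
      have h1 := ih.pull (F (Pi.single i 1))
      have h2 := (hF i y hy).smul ((-1) ^ s.card)
      convert h1.add h2 using 1
      rw [map_sub, map_smul, ← pull_comp, smul_add, pow_succ, mul_neg_one, neg_smul]
      abel
  have h01 : ∀ a : ZMod 2, a = if a = 1 then 1 else 0 := by decide
  have hsum : g = ∑ i ∈ Finset.univ.filter (fun i => g i = 1), Pi.single i 1 := by
    funext j
    rw [Finset.sum_apply, Finset.sum_filter]
    simp only [Pi.single_apply]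
    rw [Finset.sum_eq_single j]
    · simpa using h01 (g j)
    · intro i _ hij
      simp [hij.symm]
    · simp
  have hcard : Odd (Finset.univ.filter (fun i => g i = 1)).card := by
    rw [← ZMod.natCast_eq_one_iff_odd, Finset.card_filter]
    push_cast
    exact (Finset.sum_congr rfl fun i _ => (h01 (g i)).symm).trans hg
  have h1 := key (Finset.univ.filter (fun i => g i = 1))
  rw [← hsum, hcard.neg_one_pow, neg_one_smul, sub_neg_eq_add, add_comm] at h1
  exact h1

end SingularCochain

/-! ### Reflections on the cohomology of the sphere. -/

namespace unitSphere

open SingularCochain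

/-- The sphere without two opposite poles. -/
abbrev band (i : ZMod 3) : Set unitSphere := cap i ∩ flip (Pi.single i 1) ⁻¹' cap i

lemma mem_band {i : ZMod 3} {x : unitSphere} : x ∈ band i ↔ ∃ j, j ≠ i ∧ x.1 j ≠ 0 := by
  rw [band, preimage_cap]
  change (x.1 i ≠ -1 ∧ x.1 i ≠ 1) ↔ _
  constructor
  · rintro ⟨h1, h2⟩
    by_contra! h
    exact (sq_eq_one_iff.1 (sq_eq_one_of_forall h)).elim h2 h1
  · rintro ⟨j, hj, h⟩
    exact ⟨fun h1 => h (eq_zero_of_sq_eq_one (i := i) (by rw [h1]; norm_num) hj),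
      fun h1 => h (eq_zero_of_sq_eq_one (i := i) (by rw [h1]; norm_num) hj)⟩

lemma normalize_ne_zero {A : Type} [TopologicalSpace A] (h : C(A, ZMod 3 → ℝ))
    (h0 : ∀ a, h a ≠ 0) {a : A} {i : ZMod 3} (hi : h a i ≠ 0) : (normalize h h0 a).1 i ≠ 0 :=
  div_ne_zero hi (Real.sqrt_pos.2 (sum_sq_pos (h0 a))).ne'

/-- The band is the image, under radial projection, of three-space minus a line; the complement of a
subspace of codimension two is path connected. -/
instance (i : ZMod 3) : PathConnectedSpace (band i) := by
  let E : Submodule ℝ (ZMod 3 → ℝ) := ℝ ∙ Pi.single i 1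
  have hE : ∀ x : ZMod 3 → ℝ, x ∉ E → ∃ j, j ≠ i ∧ x j ≠ 0 := fun x hx => by
    by_contra! h
    refine hx (Submodule.mem_span_singleton.2 ⟨x i, funext fun j => ?_⟩)
    by_cases hj : j = i
    · subst hj
      simp
    · simp [hj, h j hj]
  have hrank : 1 < Module.rank ℝ ((ZMod 3 → ℝ) ⧸ E) := by
    have h1 := E.finrank_quotient_add_finrank
    have h2 : Module.finrank ℝ E = 1 := finrank_span_singleton (by simp)
    have h3 : Module.finrank ℝ (ZMod 3 → ℝ) = 3 := by simp
    rw [← Module.finrank_eq_rank]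
    exact_mod_cast (by omega : 1 < Module.finrank ℝ ((ZMod 3 → ℝ) ⧸ E))
  have := isPathConnected_iff_pathConnectedSpace.1 (isPathConnected_compl_of_one_lt_codim hrank)
  have h0 : ∀ x : ↥((E : Set (ZMod 3 → ℝ))ᶜ), x.1 ≠ 0 :=
    fun x h => x.2 (by rw [h]; exact E.zero_mem)
  let f := normalize ⟨fun x : ↥((E : Set (ZMod 3 → ℝ))ᶜ) => x.1, continuous_subtype_val⟩ h0
  have hf : ∀ x, f x ∈ band i := fun x => by
    obtain ⟨j, hj, h⟩ := hE x.1 x.2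
    exact mem_band.2 ⟨j, hj, normalize_ne_zero _ h0 h⟩
  refine Function.Surjective.pathConnectedSpace (f := cores (band i) f hf) (fun x => ?_)
    (ContinuousMap.continuous _)
  obtain ⟨j, hj, h⟩ := mem_band.1 x.2
  refine ⟨⟨x.1.1, fun hx => ?_⟩, Subtype.ext (normalize_eq _ _ _ _ rfl)⟩
  obtain ⟨c, hc⟩ := Submodule.mem_span_singleton.1 hx
  rw [← hc] at h
  simp [hj] at h

/-- The first cohomology of the sphere vanishes. -/
lemma isCob_one {y : Coch 1 unitSphere} (hy : IsCocycle y) : IsCob y := by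
  refine isCob_of_val_univ (cap_union 0) (isCob_union_of_pathConnected (isOpen_cap 0)
    ((isOpen_cap 0).preimage (ContinuousMap.continuous _)) hy (isCob_cap 0 hy) ?_)
  have h := (isCob_cap 0 (hy.pull (flip (Pi.single 0 1)))).pull
    (cores (cap 0) ((flip (Pi.single 0 1)).comp (val (flip (Pi.single 0 1) ⁻¹' cap 0)))
      fun x => x.2)
  rw [← pull_comp, ← pull_comp] at h
  convert h using 1
  exact congrArg (fun f : C(_, unitSphere) => pull f y)
    (ContinuousMap.ext fun x => (flip_flip _ x.1).symm)

/-- The homotopy from the identity of the band to the projection to its equator. -/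
noncomputable def bandHomotopy (i : ZMod 3) : C(unitInterval × band i, band i) :=
  cores (band i) (normalize
    ⟨fun p : unitInterval × band i => Function.update (p.2.1.1 : ZMod 3 → ℝ) i
      ((1 - (p.1 : ℝ)) * p.2.1.1 i), by
        have h : Continuous fun p : unitInterval × band i => (p.2.1.1 : ZMod 3 → ℝ) :=
          continuous_subtype_val.comp (continuous_subtype_val.comp continuous_snd)
        exact h.update i ((continuous_const.sub (continuous_subtype_val.comp continuous_fst)).mul
          ((continuous_apply i).comp h))⟩ <| by
      rintro ⟨t, x, hx⟩ h
      obtain ⟨j, hj, h'⟩ := mem_band.1 hx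
      exact h' (by simpa [hj] using congrFun h j)) <| by
    rintro ⟨t, x, hx⟩
    obtain ⟨j, hj, h'⟩ := mem_band.1 hx
    exact mem_band.2 ⟨j, hj, normalize_ne_zero _ _ (by simpa [hj] using h')⟩

/-- Each coordinate reflection acts by `-1` on the top cohomology of the sphere. -/
lemma isCob_add_pull_flip_single {n : ℕ} (i : ZMod 3) {y : Coch (n + 2) unitSphere}
    (hy : IsCocycle y) : IsCob (y + pull (flip (Pi.single i 1)) y) := by
  refine isCob_add_pull_of_swap (flip_flip _) (isOpen_cap i) (cap_union i)
    (fun y hy => isCob_cap i hy) (fun c hc => ?_) hy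
  set s : C(band i, band i) := cores (band i) ((flip (Pi.single i 1)).comp (val _)) _
  let r : C(band i, band i) := (bandHomotopy i).comp
    ((ContinuousMap.const _ 1).prodMk (ContinuousMap.id _))
  have F : (ContinuousMap.id (band i)).Homotopy r :=
    { toContinuousMap := bandHomotopy i
      map_zero_left := fun x => Subtype.ext (normalize_eq _ _ _ _ (by simp))
      map_one_left := fun x => rfl }
  -- The projection `r` to the equator forgets the reflected coordinate and is homotopic to the
  -- identity, so the reflection acts trivially on the cohomology of the band.
  have hrs : r.comp s = r := by
    ext x : 1
    have e : Function.update (s x).1.1 i ((1 - ((1 : unitInterval) : ℝ)) * (s x).1.1 i) =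
        Function.update x.1.1 i ((1 - ((1 : unitInterval) : ℝ)) * x.1.1 i) := by
      funext j
      by_cases hj : j = i
      · subst hj
        simp
      · rw [Function.update_of_ne hj, Function.update_of_ne hj]
        change bitSign ((Pi.single i 1 : ZMod 3 → ZMod 2) j) * x.1.1 j = _
        rw [Pi.single_eq_of_ne hj, bitSign_zero, one_mul]
    refine Subtype.ext (Subtype.ext (funext fun j => ?_))
    change Function.update (s x).1.1 i ((1 - ((1 : unitInterval) : ℝ)) * (s x).1.1 i) j / _ =
      Function.update x.1.1 i ((1 - ((1 : unitInterval) : ℝ)) * x.1.1 i) j / _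
    rw [e]
    congr 2
    refine Finset.sum_congr rfl fun k _ => ?_
    exact congrArg (· ^ 2) (congrFun e k)
  have h1 := isCob_pull_sub_pull F hc
  have h2 := (h1.pull s).sub h1
  rw [map_sub, ← pull_comp, hrs, ← pull_comp] at h2
  convert h2 using 1
  change c - pull s c = pull r c - pull s c - (pull r c - c)
  abel

/-- Elements with an odd number of reflections act by `-1` on the top cohomology of the sphere. -/
lemma isCob_add_pull_flip {n : ℕ} {g : ZMod 3 → ZMod 2} (hg : ∑ i, g i = 1)
    {y : Coch (n + 2) unitSphere} (hy : IsCocycle y) : IsCob (y + pull (flip g) y) :=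
  isCob_add_pull_of_odd flip_zero flip_add (fun i _ h => isCob_add_pull_flip_single i h) hg hy

end unitSphere

/-! ## Convex polygons -/

namespace ConvexPolygon

variable {q : ℕ} (A : ConvexPolygon q)

/-- The affine function that vanishes on the `i`-th edge. -/
def height (i : ZMod q) (p : ℝ × ℝ) : ℝ :=
  ((A.vertex (i + 1)).1 - (A.vertex i).1) * (p.2 - (A.vertex i).2) -
    ((A.vertex (i + 1)).2 - (A.vertex i).2) * (p.1 - (A.vertex i).1)

lemma continuous_height (i : ZMod q) : Continuous (A.height i) := by
  unfold height
  fun_prop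

lemma height_combo (i : ZMod q) (t : ℝ) (p p' : ℝ × ℝ) :
    A.height i ((1 - t) • p + t • p') = (1 - t) * A.height i p + t * A.height i p' := by
  simp only [height, Prod.fst_add, Prod.snd_add, Prod.smul_fst, Prod.smul_snd, smul_eq_mul]
  ring

lemma height_sum {κ : Type} {s : Finset κ} {w : κ → ℝ} (i : ZMod q) (hw : ∑ j ∈ s, w j = 1)
    (v : κ → ℝ × ℝ) :
    A.height i (∑ j ∈ s, w j • v j) = ∑ j ∈ s, w j * A.height i (v j) := by
  simp only [height, Prod.fst_sum, Prod.snd_sum, Prod.smul_fst, Prod.smul_snd, smul_eq_mul]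
  have e : ∀ a b c e : ℝ, a * (∑ j ∈ s, w j * (v j).2 - b) - c * (∑ j ∈ s, w j * (v j).1 - e) =
      ∑ j ∈ s, w j * (a * ((v j).2 - b) - c * ((v j).1 - e)) := by
    intro a b c e
    have h1 : a * b = ∑ j ∈ s, w j * (a * b) := by rw [← Finset.sum_mul, hw, one_mul]
    have h2 : c * e = ∑ j ∈ s, w j * (c * e) := by rw [← Finset.sum_mul, hw, one_mul]
    rw [mul_sub, mul_sub, h1, h2, Finset.mul_sum, Finset.mul_sum, ← Finset.sum_sub_distrib,
      ← Finset.sum_sub_distrib, ← Finset.sum_sub_distrib]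
    exact Finset.sum_congr rfl fun j _ => by ring
  exact e _ _ _ _

lemma height_vertex_self (i : ZMod q) : A.height i (A.vertex i) = 0 := by
  simp [height]

lemma height_vertex_succ (i : ZMod q) : A.height i (A.vertex (i + 1)) = 0 := by
  simp only [height]
  ring

lemma height_vertex_pos {i j : ZMod q} (h1 : j ≠ i) (h2 : j ≠ i + 1) :
    0 < A.height i (A.vertex j) := A.convex i j h1 h2

lemma height_vertex_eq_zero_iff {i j : ZMod q} :
    A.height i (A.vertex j) = 0 ↔ j = i ∨ j = i + 1 := by
  constructor
  · intro h
    by_contra! h'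
    exact (A.height_vertex_pos h'.1 h'.2).ne' h
  · rintro (rfl | rfl)
    · exact A.height_vertex_self _
    · exact A.height_vertex_succ _

lemma height_vertex_nonneg (i j : ZMod q) : 0 ≤ A.height i (A.vertex j) := by
  by_cases h : j = i ∨ j = i + 1
  · exact (A.height_vertex_eq_zero_iff.2 h).ge
  · push Not at h
    exact (A.height_vertex_pos h.1 h.2).le

lemma neZero {q : ℕ} (A : ConvexPolygon q) : NeZero q := ⟨by have := A.three_le; omega⟩

lemma natCast_inj {a b : ℕ} (ha : a < q) (hb : b < q) :
    ((a : ℕ) : ZMod q) = (b : ℕ) ↔ a = b := by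
  rw [ZMod.natCast_eq_natCast_iff', Nat.mod_eq_of_lt ha, Nat.mod_eq_of_lt hb]

lemma one_ne_zero {q : ℕ} (A : ConvexPolygon q) : (1 : ZMod q) ≠ 0 := by
  have h3 := A.three_le
  have := (natCast_inj (q := q) (a := 1) (b := 0) (by omega) (by omega)).not.2 (by omega)
  simpa using this

lemma two_ne_zero {q : ℕ} (A : ConvexPolygon q) : (1 + 1 : ZMod q) ≠ 0 := by
  have h3 := A.three_le
  have := (natCast_inj (q := q) (a := 2) (b := 0) (by omega) (by omega)).not.2 (by omega)
  intro h
  refine this ?_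
  push_cast
  rw [← h]
  norm_num

lemma vertex_mem (i : ZMod q) : A.vertex i ∈ A.carrier := subset_convexHull ℝ _ ⟨i, rfl⟩

lemma convex_carrier : Convex ℝ A.carrier := convex_convexHull ℝ _

lemma combo_mem {p p' : ℝ × ℝ} (hp : p ∈ A.carrier) (hp' : p' ∈ A.carrier) {t : ℝ} (h0 : 0 ≤ t)
    (h1 : t ≤ 1) : (1 - t) • p + t • p' ∈ A.carrier :=
  A.convex_carrier hp hp' (by linarith) h0 (by ring)

/-- The sums are `finsum`s because finiteness of `ZMod q` is known only through `A.three_le`, inside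
the proof. -/
lemma exists_combo {p : ℝ × ℝ} (hp : p ∈ A.carrier) :
    ∃ w : ZMod q → ℝ, (∀ j, 0 ≤ w j) ∧ (∑ᶠ j, w j = 1) ∧ (∑ᶠ j, w j • A.vertex j = p) ∧
      ∀ i, A.height i p = ∑ᶠ j, w j * A.height i (A.vertex j) := by
  have := A.neZero
  rw [carrier, convexHull_range_eq_exists_affineCombination] at hp
  obtain ⟨s, w, hw0, hw1, hw⟩ := hp
  rw [Finset.affineCombination_eq_linear_combination _ _ _ hw1] at hw
  classical
  refine ⟨fun j => if j ∈ s then w j else 0, fun j => ?_, ?_, ?_, fun i => ?_⟩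
  · dsimp only
    split_ifs with h
    · exact hw0 j h
    · exact le_rfl
  · rw [finsum_eq_sum_of_fintype]
    simpa using hw1
  · rw [finsum_eq_sum_of_fintype]
    simpa using hw
  · rw [finsum_eq_sum_of_fintype, ← hw]
    simp only [ite_mul, zero_mul, Finset.sum_ite_mem, Finset.univ_inter]
    exact A.height_sum i hw1 _

lemma height_nonneg {p : ℝ × ℝ} (hp : p ∈ A.carrier) (i : ZMod q) : 0 ≤ A.height i p := by
  obtain ⟨w, h0, -, -, h⟩ := A.exists_combo hp
  rw [h]
  exact finsum_nonneg fun j => mul_nonneg (h0 j) (A.height_vertex_nonneg i j)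

/-- The height of `p` is a nonnegative combination of vertex heights, which are positive away from
the endpoints of the edge; if it is zero, only the endpoints carry weight. -/
lemma height_eq_zero_iff {p : ℝ × ℝ} (hp : p ∈ A.carrier) (i : ZMod q) :
    A.height i p = 0 ↔ p ∈ A.edge i := by
  have := A.neZero
  constructor
  · intro h
    obtain ⟨w, h0, h1, h2, h3⟩ := A.exists_combo hp
    rw [finsum_eq_sum_of_fintype] at h1 h2
    rw [h3, finsum_eq_sum_of_fintype, Finset.sum_eq_zero_iff_of_nonneg
      fun j _ => mul_nonneg (h0 j) (A.height_vertex_nonneg i j)] at h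
    have hz : ∀ j, j ≠ i ∧ j ≠ i + 1 → w j = 0 := fun j hj =>
      (mul_eq_zero.1 (h j (Finset.mem_univ j))).resolve_right
        (A.height_vertex_pos hj.1 hj.2).ne'
    have hne : i ≠ i + 1 := fun h => A.one_ne_zero (left_eq_add.1 h)
    rw [Fintype.sum_eq_add i (i + 1) hne fun j hj => hz j hj] at h1
    rw [Fintype.sum_eq_add i (i + 1) hne fun j hj => by rw [hz j hj, zero_smul]] at h2
    exact ⟨w i, w (i + 1), h0 _, h0 _, h1, h2⟩
  · rintro ⟨a, b, -, -, hab, rfl⟩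
    obtain rfl : a = 1 - b := by linarith
    rw [height_combo, height_vertex_self, height_vertex_succ]
    ring

/-- The edges through a point of the polygon are edges through a vertex. -/
lemma exists_vertex_edges {p : ℝ × ℝ} (hp : p ∈ A.carrier) :
    ∃ k, ∀ i, A.height i p = 0 → i = k - 1 ∨ i = k := by
  by_cases h : ∃ i, A.height i p = 0
  · obtain ⟨i, hi⟩ := h
    obtain ⟨a, b, ha, hb, hab, rfl⟩ := (A.height_eq_zero_iff hp i).1 hi
    obtain rfl : a = 1 - b := by linarith
    by_cases hb0 : b = 0
    · refine ⟨i, fun j hj => ?_⟩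
      subst hb0
      rw [height_combo, zero_mul, add_zero, sub_zero, one_mul, height_vertex_eq_zero_iff] at hj
      rcases hj with h | h
      · exact Or.inr h.symm
      · exact Or.inl (eq_sub_of_add_eq h.symm)
    by_cases hb1 : 1 - b = 0
    · refine ⟨i + 1, fun j hj => ?_⟩
      obtain rfl : b = 1 := by linarith
      rw [height_combo, sub_self, zero_mul, zero_add, one_mul, height_vertex_eq_zero_iff] at hj
      rcases hj with h | h
      · exact Or.inr h.symm
      · exact Or.inl (eq_sub_of_add_eq h.symm)
    · refine ⟨i, fun j hj => Or.inr ?_⟩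
      rw [height_combo, add_eq_zero_iff_of_nonneg (mul_nonneg ha (A.height_vertex_nonneg _ _))
        (mul_nonneg hb (A.height_vertex_nonneg _ _)), mul_eq_zero, mul_eq_zero,
        height_vertex_eq_zero_iff, height_vertex_eq_zero_iff] at hj
      rcases hj.1.resolve_left hb1 with h | h
      · exact h.symm
      rcases hj.2.resolve_left hb0 with h' | h'
      · rw [h, add_assoc, add_eq_left] at h'
        exact absurd h' A.two_ne_zero
      · exact (add_right_cancel h').symm
  · push Not at h
    -- A point on no edge: any vertex serves.
    exact ⟨0, fun i hi => absurd hi (h i)⟩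

/-- A point of the polygon that lies exactly on the edges in `J`. -/
def IsCenter (J : Set (ZMod q)) (c : ℝ × ℝ) : Prop :=
  c ∈ A.carrier ∧ ∀ i, A.height i c = 0 ↔ i ∈ J

lemma isCenter_vertex (k : ZMod q) : A.IsCenter {k - 1, k} (A.vertex k) := by
  refine ⟨A.vertex_mem k, fun i => ?_⟩
  rw [height_vertex_eq_zero_iff, Set.mem_insert_iff, Set.mem_singleton_iff, or_comm,
    eq_comm (a := k) (b := i), eq_sub_iff_add_eq, eq_comm (a := k)]

lemma isCenter_edge (i : ZMod q) : ∃ c, A.IsCenter {i} c := by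
  refine ⟨(1 - 1 / 2 : ℝ) • A.vertex i + (1 / 2 : ℝ) • A.vertex (i + 1),
    A.combo_mem (A.vertex_mem _) (A.vertex_mem _) (by norm_num) (by norm_num), fun j => ?_⟩
  have h1 := A.height_vertex_nonneg j i
  have h2 := A.height_vertex_nonneg j (i + 1)
  rw [height_combo, Set.mem_singleton_iff]
  constructor
  · intro h
    have h3 : A.height j (A.vertex i) = 0 := by linarith
    have h4 : A.height j (A.vertex (i + 1)) = 0 := by linarith
    rw [height_vertex_eq_zero_iff] at h3 h4
    rcases h3 with h | h
    · exact h.symm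
    rcases h4 with h' | h'
    · rw [h, add_assoc, add_eq_left] at h'
      exact absurd h' A.two_ne_zero
    · exact (add_right_cancel h').symm
  · rintro rfl
    rw [height_vertex_self, height_vertex_succ]
    ring

/-! ### The surface over a polygon -/

/-- The surface glued from copies of the polygon, one for each choice of signs: the points
`(x, p)` where `p` lies in the polygon and `x i ^ 2` is the height of `p` over the `i`-th edge. -/
def surface : Set ((ZMod q → ℝ) × (ℝ × ℝ)) :=
  {z | z.2 ∈ A.carrier ∧ ∀ i, z.1 i ^ 2 = A.height i z.2}

namespace surface

open SingularCochain

variable {A}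

lemma coord_eq_zero_iff (z : A.surface) (i : ZMod q) :
    z.1.1 i = 0 ↔ A.height i z.1.2 = 0 := by
  rw [← z.2.2 i, sq_eq_zero_iff]

lemma continuous_coord (i : ZMod q) : Continuous fun z : A.surface => z.1.1 i :=
  (continuous_apply i).comp (continuous_fst.comp continuous_subtype_val)

lemma continuous_point : Continuous fun z : A.surface => z.1.2 :=
  continuous_snd.comp continuous_subtype_val

/-- A change of signs of the coordinates. -/
noncomputable def flip (g : ZMod q → ZMod 2) : C(A.surface, A.surface) where
  toFun z := ⟨(fun i => bitSign (g i) * z.1.1 i, z.1.2), z.2.1, fun i => by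
    rw [mul_pow, bitSign_sq, one_mul]
    exact z.2.2 i⟩
  continuous_toFun := by
    refine Continuous.subtype_mk (Continuous.prodMk (continuous_pi fun i => ?_)
      continuous_point) _
    exact continuous_const.mul (continuous_coord i)

lemma flip_coord (g : ZMod q → ZMod 2) (z : A.surface) (i : ZMod q) :
    (flip g z).1.1 i = bitSign (g i) * z.1.1 i := rfl

lemma ext {z z' : A.surface} (h1 : ∀ i, z.1.1 i = z'.1.1 i) (h2 : z.1.2 = z'.1.2) : z = z' :=
  Subtype.ext (Prod.ext (funext h1) h2)

lemma flip_add (g h : ZMod q → ZMod 2) :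
    (flip (g + h) : C(A.surface, A.surface)) = (flip g).comp (flip h) := by
  refine ContinuousMap.ext fun z => ext (fun i => ?_) rfl
  change bitSign (g i + h i) * z.1.1 i = bitSign (g i) * (bitSign (h i) * z.1.1 i)
  rw [bitSign_add, mul_assoc]

lemma flip_zero : (flip 0 : C(A.surface, A.surface)) = ContinuousMap.id _ := by
  refine ContinuousMap.ext fun z => ext (fun i => ?_) rfl
  change bitSign 0 * z.1.1 i = z.1.1 i
  rw [bitSign_zero, one_mul]

/-- The open star: points that lie on no edges but those in `J`. -/
def star (A : ConvexPolygon q) (J : Set (ZMod q)) : Set A.surface := {z | ∀ i ∉ J, z.1.1 i ≠ 0}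

lemma isOpen_star (J : Set (ZMod q)) : IsOpen (star A J) := by
  have := A.neZero
  simp only [star, Set.ofPred_forall]
  exact isOpen_iInter_of_finite fun i => isOpen_iInter_of_finite fun _ =>
    isOpen_ne_fun (continuous_coord i) continuous_const

lemma star_mono {J J' : Set (ZMod q)} (h : J ⊆ J') : star A J ⊆ star A J' :=
  fun _ hz i hi => hz i fun h' => hi (h h')

lemma star_inter (J J' : Set (ZMod q)) : star A J ∩ star A J' = star A (J ∩ J') := by
  ext z
  constructor
  · rintro ⟨h1, h2⟩ i hi
    by_cases h : i ∈ J
    · exact h2 i fun h' => hi ⟨h, h'⟩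
    · exact h1 i h
  · exact fun h => ⟨star_mono Set.inter_subset_left h, star_mono Set.inter_subset_right h⟩

open Classical in
/-- The contraction of an open star to its centres. -/
noncomputable def contract {J : Set (ZMod q)} {c : ℝ × ℝ} (hc : A.IsCenter J c) :
    C(unitInterval × star A J, star A J) where
  -- The point moves linearly to `c`, so the squares of the coordinates must interpolate linearly
  -- between heights. For `i ∈ J` the height of `c` is zero and the coordinate, which may vanish, is
  -- simply scaled. For `i ∉ J` it is nonzero on the star, so its sign `x / |x|` is continuous and
  -- is kept.
  toFun p := ⟨⟨(fun i => if i ∈ J then √(1 - (p.1 : ℝ)) * p.2.1.1.1 i else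
      p.2.1.1.1 i / |p.2.1.1.1 i| * √((1 - (p.1 : ℝ)) * p.2.1.1.1 i ^ 2 +
        (p.1 : ℝ) * A.height i c), (1 - (p.1 : ℝ)) • p.2.1.1.2 + (p.1 : ℝ) • c),
      A.combo_mem p.2.1.2.1 hc.1 p.1.2.1 p.1.2.2, fun i => by
        have h0 : 0 ≤ 1 - (p.1 : ℝ) := by linarith [p.1.2.2]
        dsimp only
        rw [A.height_combo, ← p.2.1.2.2 i]
        split_ifs with hi
        · rw [mul_pow, Real.sq_sqrt h0, (hc.2 i).2 hi, mul_zero, add_zero]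
        · rw [mul_pow, div_pow, sq_abs, div_self (pow_ne_zero 2 (p.2.2 i hi)), one_mul,
            Real.sq_sqrt]
          exact add_nonneg (mul_nonneg h0 (sq_nonneg _))
            (mul_nonneg p.1.2.1 (A.height_nonneg hc.1 i))⟩, fun i hi => by
        have h0 : 0 ≤ 1 - (p.1 : ℝ) := by linarith [p.1.2.2]
        have h1 : 0 < p.2.1.1.1 i ^ 2 := sq_pos_of_ne_zero (p.2.2 i hi)
        have h2 : 0 < A.height i c :=
          lt_of_le_of_ne (A.height_nonneg hc.1 i) fun h => hi ((hc.2 i).1 h.symm)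
        dsimp only
        rw [if_neg hi]
        refine mul_ne_zero (div_ne_zero (p.2.2 i hi) (abs_ne_zero.2 (p.2.2 i hi)))
          (Real.sqrt_pos.2 ?_).ne'
        rcases p.1.2.1.eq_or_lt with h | h
        · rw [← h, sub_zero, one_mul, zero_mul, add_zero]
          exact h1
        · exact add_pos_of_nonneg_of_pos (mul_nonneg h0 h1.le) (mul_pos h h2)⟩
  continuous_toFun := by
    have hx : ∀ i, Continuous fun p : unitInterval × star A J => p.2.1.1.1 i := fun i =>
      (continuous_coord i).comp (continuous_subtype_val.comp continuous_snd)
    have hp : Continuous fun p : unitInterval × star A J => p.2.1.1.2 :=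
      continuous_point.comp (continuous_subtype_val.comp continuous_snd)
    refine Continuous.subtype_mk (Continuous.subtype_mk (Continuous.prodMk
      (continuous_pi fun i => ?_) (by fun_prop)) _) _
    split_ifs with hi
    · have := hx i
      fun_prop
    · have := hx i
      refine Continuous.mul ((hx i).div (hx i).abs fun p => abs_ne_zero.2 (p.2.2 i hi)) ?_
      fun_prop

open Classical in
lemma contract_coord {J : Set (ZMod q)} {c : ℝ × ℝ} (hc : A.IsCenter J c)
    (t : unitInterval) (z : star A J) (i : ZMod q) :
    (contract hc (t, z)).1.1.1 i = if i ∈ J then √(1 - (t : ℝ)) * z.1.1.1 i else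
      z.1.1.1 i / |z.1.1.1 i| * √((1 - (t : ℝ)) * z.1.1.1 i ^ 2 + (t : ℝ) * A.height i c) := rfl

lemma contract_point {J : Set (ZMod q)} {c : ℝ × ℝ} (hc : A.IsCenter J c)
    (t : unitInterval) (z : star A J) :
    (contract hc (t, z)).1.1.2 = (1 - (t : ℝ)) • z.1.1.2 + (t : ℝ) • c := rfl

lemma contract_zero {J : Set (ZMod q)} {c : ℝ × ℝ} (hc : A.IsCenter J c) (z : star A J) :
    contract hc (0, z) = z := by
  refine Subtype.ext (ext (fun i => ?_) ?_)
  · rw [contract_coord]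
    split_ifs with hi
    · simp
    · have := z.2 i hi
      simp only [Set.Icc.coe_zero, sub_zero, one_mul, zero_mul, add_zero, Real.sqrt_sq_eq_abs]
      exact div_mul_cancel₀ _ (abs_ne_zero.2 this)
  · rw [contract_point]
    simp

/-- The end of the contraction. -/
noncomputable def retract {J : Set (ZMod q)} {c : ℝ × ℝ} (hc : A.IsCenter J c) :
    C(star A J, star A J) :=
  (contract hc).comp ((ContinuousMap.const _ 1).prodMk (ContinuousMap.id _))

open Classical in
lemma retract_coord {J : Set (ZMod q)} {c : ℝ × ℝ} (hc : A.IsCenter J c) (z : star A J)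
    (i : ZMod q) : (retract hc z).1.1.1 i =
      if i ∈ J then 0 else z.1.1.1 i / |z.1.1.1 i| * √(A.height i c) := by
  refine (contract_coord hc 1 z i).trans ?_
  simp

lemma retract_point {J : Set (ZMod q)} {c : ℝ × ℝ} (hc : A.IsCenter J c) (z : star A J) :
    (retract hc z).1.1.2 = c := by
  refine (contract_point hc 1 z).trans ?_
  simp

/-- The homotopy from the identity of an open star to the retraction. -/
noncomputable def retractHomotopy {J : Set (ZMod q)} {c : ℝ × ℝ} (hc : A.IsCenter J c) :
    (ContinuousMap.id (star A J)).Homotopy (retract hc) where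
  toContinuousMap := contract hc
  map_zero_left z := contract_zero hc z
  map_one_left _ := rfl

/-- The end of the contraction depends only on the signs of the coordinates outside `J`, which do
not vanish on the star. -/
lemma isLocallyConstant_retract {J : Set (ZMod q)} {c : ℝ × ℝ} (hc : A.IsCenter J c) :
    IsLocallyConstant (retract hc) := by
  have := A.neZero
  rw [IsLocallyConstant.iff_eventually_eq]
  intro z
  have h : ∀ i, ∀ᶠ z' : star A J in nhds z,
      (retract hc z').1.1.1 i = (retract hc z).1.1.1 i := fun i => by
    by_cases hi : i ∈ J
    · refine Filter.Eventually.of_forall fun z' => ?_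
      rw [retract_coord, retract_coord, if_pos hi, if_pos hi]
    · have hcont : Continuous fun z : star A J => z.1.1.1 i :=
        (continuous_coord i).comp continuous_subtype_val
      rcases lt_or_gt_of_ne (z.2 i hi) with h | h
      · filter_upwards [hcont.continuousAt.eventually_lt continuousAt_const h] with z' hz'
        rw [retract_coord, retract_coord, if_neg hi, if_neg hi, abs_of_neg h, abs_of_neg hz',
          div_neg, div_neg, div_self hz'.ne, div_self h.ne]
      · filter_upwards [continuousAt_const.eventually_lt hcont.continuousAt h] with z' hz'
        rw [retract_coord, retract_coord, if_neg hi, if_neg hi, abs_of_pos h, abs_of_pos hz',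
          div_self hz'.ne', div_self h.ne']
  filter_upwards [Filter.eventually_all.2 h] with z' hz'
  exact Subtype.ext (ext hz' ((retract_point hc z').trans (retract_point hc z).symm))

end surface

end ConvexPolygon

/-! ## Cohomology of the surface over a polygon -/

namespace ConvexPolygon.surface

open SingularCochain

variable {q : ℕ} {A : ConvexPolygon q} {Y : Type} [TopologicalSpace Y]

/-- The inclusion of a slice of a product. -/
def slice (Y : Type) [TopologicalSpace Y] {X : Type} [TopologicalSpace X] (x : X) : C(Y, Y × X) :=
  (ContinuousMap.id Y).prodMk (ContinuousMap.const Y x)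

/-- A class on the product of a space with an open star vanishes if it vanishes on slices. -/
lemma isCob_prod_star {J : Set (ZMod q)} {c : ℝ × ℝ} (hc : A.IsCenter J c) {n : ℕ}
    {y : Coch (n + 1) (Y × star A J)} (hy : IsCocycle y)
    (hs : ∀ z, IsCob (pull (slice Y z) y)) : IsCob y := by
  have h1 := isCob_pull_sub_pull
    ((ContinuousMap.Homotopy.refl (ContinuousMap.id Y)).prodMap (retractHomotopy hc)) hy
  have h2 : IsCob (pull ((ContinuousMap.id Y).prodMap (retract hc)) y) := by
    -- Locally in the star factor, the retraction is projection to `Y` followed by the inclusion of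
    -- one slice.
    refine isCob_pull_of_locallyConstant _
      ((isLocallyConstant_retract hc).comp_continuous continuous_snd)
      (fun z => (slice Y z).comp ContinuousMap.fst) (fun _ => rfl) fun z => ?_
    rw [pull_comp]
    exact (hs z).pull _
  convert h2.sub h1 using 1
  rw [sub_sub_cancel]
  rfl

/-- The part of a product with the surface over a subset. -/
abbrev slab (Y : Type) [TopologicalSpace Y] (B : Set A.surface) : Set (Y × A.surface) :=
  Prod.snd ⁻¹' B

lemma isCob_slab_star {J : Set (ZMod q)} {c : ℝ × ℝ} (hc : A.IsCenter J c) {n : ℕ}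
    {y : Coch (n + 1) ↥(slab Y (star A J))} (hy : IsCocycle y)
    (hs : ∀ (z : A.surface) (hz : z ∈ star A J),
      IsCob (pull (cores (slab Y (star A J)) (slice Y z) fun _ => hz) y)) : IsCob y := by
  let e : C(↥(slab Y (star A J)), Y × star A J) :=
    (ContinuousMap.fst.comp (val _)).prodMk
      (cores _ (ContinuousMap.snd.comp (val _)) fun p => p.2)
  let f : C(Y × star A J, ↥(slab Y (star A J))) :=
    cores _ ((ContinuousMap.id Y).prodMap (val _)) fun p => p.2.2
  exact (isCob_prod_star hc (hy.pull f) fun z => hs z.1 z.2).pull e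

/-- A union of consecutive vertex stars. -/
def chain (A : ConvexPolygon q) (k : ZMod q) (m : ℕ) : Set A.surface :=
  {z | ∃ j ≤ m, z ∈ star A {k + (j : ℕ), k + (j : ℕ) + 1}}

lemma isOpen_chain (k : ZMod q) (m : ℕ) : IsOpen (chain A k m) := by
  have : chain A k m = ⋃ j, ⋃ _ : j ≤ m, star A {k + (j : ℕ), k + (j : ℕ) + 1} := by
    ext z
    simp [chain]
  rw [this]
  exact isOpen_iUnion fun j => isOpen_iUnion fun _ => isOpen_star _

lemma isCenter_succ (k : ZMod q) : A.IsCenter {k, k + 1} (A.vertex (k + 1)) := by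
  have := A.isCenter_vertex (k + 1)
  rwa [add_sub_cancel_right] at this

lemma chain_zero (k : ZMod q) : chain A k 0 = star A {k, k + 1} := by
  ext z
  simp [chain]

lemma chain_succ (k : ZMod q) (m : ℕ) :
    chain A k (m + 1) = chain A k m ∪ star A {k + (m + 1 : ℕ), k + (m + 1 : ℕ) + 1} := by
  ext z
  constructor
  · rintro ⟨j, hj, h⟩
    rcases hj.eq_or_lt with rfl | hj
    · exact Or.inr h
    · exact Or.inl ⟨j, by omega, h⟩
  · rintro (⟨j, hj, h⟩ | h)
    · exact ⟨j, by omega, h⟩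
    · exact ⟨m + 1, le_rfl, h⟩

lemma add_natCast_ne {k : ZMod q} {a b : ℕ} (ha : a < q) (hb : b < q) (hab : a ≠ b) :
    k + (a : ℕ) ≠ k + (b : ℕ) := fun h => hab ((natCast_inj ha hb).1 (add_left_cancel h))

/-- The new vertex star shares only the edge `k + m + 1` with the earlier ones. The bound `m + 2 <
q` prevents its other edge from wrapping around to the start of the chain. -/
lemma chain_inter_star (k : ZMod q) {m : ℕ} (hm : m + 2 < q) :
    chain A k m ∩ star A {k + (m + 1 : ℕ), k + (m + 1 : ℕ) + 1} = star A {k + (m + 1 : ℕ)} := by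
  ext z
  have e : ∀ j : ℕ, k + (j : ℕ) + 1 = k + (j + 1 : ℕ) := fun j => by push_cast; ring
  constructor
  · rintro ⟨⟨j, hj, h1⟩, h2⟩
    have h3 : z ∈ star A _ ∩ star A _ := ⟨h1, h2⟩
    rw [star_inter] at h3
    refine star_mono ?_ h3
    rintro i ⟨h4, h5⟩
    rcases h5 with h5 | h5
    · exact h5
    · rw [Set.mem_singleton_iff, e] at h5
      rw [e] at h4
      rcases h4 with h4 | h4
      · exact absurd (h4.symm.trans h5) (add_natCast_ne (by omega) (by omega) (by omega))
      · exact absurd ((Set.mem_singleton_iff.1 h4).symm.trans h5)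
          (add_natCast_ne (by omega) (by omega) (by omega))
  · intro h
    refine ⟨⟨m, le_rfl, star_mono ?_ h⟩, star_mono ?_ h⟩
    · rw [e]
      exact fun i hi => Or.inr hi
    · exact fun i hi => Or.inl hi

/-- If `H¹(Y) = 0`, then a class of degree two that vanishes on slices vanishes on chains of
vertex stars. -/
lemma isCob_slab_chain (hY : ∀ c : Coch 1 Y, IsCocycle c → IsCob c) {y : Coch 2 (Y × A.surface)}
    (hy : IsCocycle y) (hs : ∀ z, IsCob (pull (slice Y z) y)) (k : ZMod q) {m : ℕ}
    (hm : m + 1 < q) : IsCob (pull (val (slab Y (chain A k m))) y) := by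
  induction m with
  | zero =>
    rw [chain_zero]
    exact isCob_slab_star (isCenter_succ k) (hy.pull _) fun z hz => hs z
  | succ m ih =>
    rw [chain_succ, slab, Set.preimage_union]
    refine isCob_union_of_inter ((isOpen_chain k m).preimage continuous_snd)
      ((isOpen_star _).preimage continuous_snd) ?_ hy (ih (by omega))
      (isCob_slab_star (isCenter_succ _) (hy.pull _) fun z hz => hs z)
    -- The overlap lies over the star of one edge, where degree-one classes are detected on slices
    -- and so vanish by `hY`.
    rw [← Set.preimage_inter, chain_inter_star k hm]
    intro c hc
    obtain ⟨o, ho⟩ := A.isCenter_edge (k + (m + 1 : ℕ))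
    exact isCob_slab_star ho hc fun z hz => hY _ (hc.pull _)

lemma exists_mem_star (z : A.surface) : ∃ i, z ∈ star A {i - 1, i} := by
  obtain ⟨i, hi⟩ := A.exists_vertex_edges z.2.1
  refine ⟨i, fun j hj h => hj ?_⟩
  exact hi j ((coord_eq_zero_iff z j).1 h)

/-- The chain starting at `k` with `m = q - 2` contains `q - 1` of the `q` vertex stars; the missing
one is at the vertex `k`. -/
lemma chain_union_star (k : ZMod q) : chain A k (q - 2) ∪ star A {k - 1, k} = Set.univ := by
  have := A.neZero
  refine Set.eq_univ_of_forall fun z => ?_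
  obtain ⟨i, hi⟩ := exists_mem_star z
  by_cases hik : i = k
  · subst hik
    exact Or.inr hi
  · left
    have h0 : (i - k).val ≠ 0 := by
      rw [Ne, ZMod.val_eq_zero]
      exact sub_ne_zero.2 hik
    have hlt := ZMod.val_lt (i - k)
    have h1 : ((((i - k).val - 1 : ℕ) : ZMod q)) + 1 = i - k := by
      conv_rhs => rw [← ZMod.natCast_zmod_val (i - k)]
      conv_rhs => rw [show (i - k).val = (i - k).val - 1 + 1 by omega]
      push_cast
      rfl
    -- The `j`-th star of the chain is the one at the vertex `k + j + 1`, hence the shift by one.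
    refine ⟨(i - k).val - 1, by omega, ?_⟩
    have e1 : k + (((i - k).val - 1 : ℕ) : ZMod q) = i - 1 := by linear_combination h1
    rw [e1, sub_add_cancel]
    exact hi

end ConvexPolygon.surface

/-! ### Path components of the surface. -/

namespace ConvexPolygon.surface

open SingularCochain

variable {q : ℕ} {A : ConvexPolygon q}

lemma flip_single_coord (k i : ZMod q) (z : A.surface) :
    (flip (Pi.single k 1) z).1.1 i = if i = k then -z.1.1 i else z.1.1 i := by
  rw [flip_coord]
  split_ifs with h
  · subst h
    rw [Pi.single_eq_same, bitSign_one, neg_one_mul]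
  · rw [Pi.single_eq_of_ne h, bitSign_zero, one_mul]

/-- Within a single copy of the polygon one walks from `z` to a point over the vertex `k`. That
point lies on the edge `k`, so it is fixed by the reflection, and the reflected path leads back to
the image of `z`. -/
lemma joined_flip_single (k : ZMod q) (z : A.surface) : Joined z (flip (Pi.single k 1) z) := by
  -- The copy containing `z`; at a vanishing coordinate either sign would do.
  set ε : ZMod q → ℝ := fun i => if z.1.1 i < 0 then -1 else 1
  have hε : ∀ i, ε i ^ 2 = 1 := fun i => by
    dsimp only [ε]
    split_ifs <;> norm_num
  have hz : ∀ i, ε i * √(A.height i z.1.2) = z.1.1 i := fun i => by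
    rw [← z.2.2 i, Real.sqrt_sq_eq_abs]
    dsimp only [ε]
    split_ifs with h
    · rw [abs_of_neg h, neg_one_mul, neg_neg]
    · rw [abs_of_nonneg (not_lt.1 h), one_mul]
  let w : unitInterval → A.surface := fun t =>
    ⟨(fun i => ε i * √(A.height i ((1 - (t : ℝ)) • z.1.2 + (t : ℝ) • A.vertex k)),
      (1 - (t : ℝ)) • z.1.2 + (t : ℝ) • A.vertex k),
      A.combo_mem z.2.1 (A.vertex_mem k) t.2.1 t.2.2, fun i => by
        rw [mul_pow, hε, one_mul, Real.sq_sqrt]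
        exact A.height_nonneg (A.combo_mem z.2.1 (A.vertex_mem k) t.2.1 t.2.2) i⟩
  have hw : Joined z (w 1) := ⟨{
    toFun := w
    continuous_toFun := by
      refine Continuous.subtype_mk (Continuous.prodMk (continuous_pi fun i => ?_)
        (by fun_prop)) _
      exact continuous_const.mul (Real.continuous_sqrt.comp
        ((A.continuous_height i).comp (by fun_prop)))
    source' := ext (fun i => by simpa [w] using hz i) (by simp [w])
    target' := rfl }⟩
  have h1 : flip (Pi.single k 1) (w 1) = w 1 := by
    refine ext (fun i => ?_) rfl
    rw [flip_single_coord]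
    split_ifs with hi
    · subst hi
      simp [w, A.height_vertex_self]
    · rfl
  have h2 := hw.map (flip (Pi.single k 1)).continuous
  rw [h1] at h2
  exact hw.trans h2.symm

/-- Sign changes do not leave a path component of the surface. -/
lemma joined_flip (g : ZMod q → ZMod 2) (z : A.surface) : Joined z (flip g z) := by
  have := A.neZero
  have h01 : ∀ a : ZMod 2, a = 0 ∨ a = 1 := by decide
  induction g using Pi.single_induction generalizing z with
  | zero =>
    rw [flip_zero]
    exact Joined.refl z
  | add g h hg hh =>
    rw [flip_add]
    exact (hh z).trans (hg _)
  | single i a =>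
    rcases h01 a with rfl | rfl
    · rw [Pi.single_zero, flip_zero]
      exact Joined.refl z
    · exact joined_flip_single i z

end ConvexPolygon.surface

/-! ## Small covers as quotients of spaces with sign coordinates -/

lemma bitSign_eq_one_iff {a : ZMod 2} : bitSign a = 1 ↔ a = 0 := by
  rw [bitSign]
  split_ifs with h <;> norm_num [h]

/-! ### The subgroup of a face in terms of sign vectors. -/

section FacetHom

variable {E ι : Type} {n : ℕ}

lemma SmallCover.mk_eq_mk_iff {lam : ι → Fin n → ZMod 2} {P : Set E} {F : ι → Set E}
    {x y : (Fin n → ZMod 2) × P} :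
    (Quotient.mk (smallCoverSetoid P F lam) x = Quotient.mk (smallCoverSetoid P F lam) y) ↔
      x.2 = y.2 ∧ x.1 + y.1 ∈ facetSubgroup F lam (x.2 : E) := Quotient.eq

variable [Fintype ι] (lam : ι → Fin n → ZMod 2)

/-- The homomorphism of sign groups given by a characteristic map. -/
abbrev facetHom : (ι → ZMod 2) →ₗ[ZMod 2] (Fin n → ZMod 2) :=
  Fintype.linearCombination (ZMod 2) lam

lemma mem_facetSubgroup_iff {F : ι → Set E} {p : E} {v : Fin n → ZMod 2} :
    v ∈ facetSubgroup F lam p ↔ ∃ c, (∀ i, c i ≠ 0 → p ∈ F i) ∧ facetHom lam c = v := by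
  classical
  constructor
  · intro h
    induction h using AddSubgroup.closure_induction with
    | mem x hx =>
      obtain ⟨i, hi, rfl⟩ := hx
      refine ⟨Pi.single i 1, fun j hj => ?_, ?_⟩
      · by_cases hij : j = i
        · exact hij ▸ hi
        · exact absurd (Pi.single_eq_of_ne hij _) hj
      · rw [Fintype.linearCombination_apply_single, one_smul]
    | zero => exact ⟨0, fun i h => absurd rfl h, map_zero _⟩
    | add x y _ _ hx hy =>
      obtain ⟨c, hc, rfl⟩ := hx
      obtain ⟨c', hc', rfl⟩ := hy
      refine ⟨c + c', fun i hi => ?_, map_add _ _ _⟩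
      by_contra h
      refine hi ?_
      rw [Pi.add_apply, not_not.1 fun h' => h (hc i h'), not_not.1 fun h' => h (hc' i h'), add_zero]
    | neg x _ hx =>
      obtain ⟨c, hc, rfl⟩ := hx
      exact ⟨-c, fun i hi => hc i (neg_ne_zero.1 hi), map_neg _ _⟩
  · rintro ⟨c, hc, rfl⟩
    rw [Fintype.linearCombination_apply]
    refine sum_mem fun i _ => ?_
    by_cases hi : c i = 0
    · rw [hi, zero_smul]
      exact zero_mem _
    · have h01 : ∀ a : ZMod 2, a = 0 ∨ a = 1 := by decide
      rw [(h01 (c i)).resolve_left hi, one_smul]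
      exact AddSubgroup.subset_closure ⟨i, hc i hi, rfl⟩

end FacetHom

/-- A space over `P` on which the sign group `ℤ₂^ι` acts, with one real coordinate for each facet:
the coordinate of a facet vanishes over the facet, and its absolute value depends only on the point
of `P`. -/
structure SignedSpace {E ι : Type} [TopologicalSpace E] (P : Set E) (F : ι → Set E) (Z : Type)
    [TopologicalSpace Z] [AddAction (ι → ZMod 2) Z] [ContinuousConstVAdd (ι → ZMod 2) Z] where
  coord : Z → ι → ℝ
  point : C(Z, P)
  sec : C(P, Z)
  coord_vadd : ∀ (g : ι → ZMod 2) (z : Z) (i : ι), coord (g +ᵥ z) i = bitSign (g i) * coord z i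
  point_vadd : ∀ (g : ι → ZMod 2) z, point (g +ᵥ z) = point z
  coord_eq_zero_iff : ∀ z i, coord z i = 0 ↔ (point z : E) ∈ F i
  point_sec : ∀ p, point (sec p) = p
  sec_nonneg : ∀ p i, 0 ≤ coord (sec p) i
  coord_sq : ∀ z i, coord (sec (point z)) i ^ 2 = coord z i ^ 2
  eq_of_coord_eq : ∀ z z', coord z = coord z' → point z = point z' → z = z'

namespace SignedSpace

variable {E ι : Type} [TopologicalSpace E] {P : Set E} {F : ι → Set E} {Z : Type}
  [TopologicalSpace Z] [AddAction (ι → ZMod 2) Z] [ContinuousConstVAdd (ι → ZMod 2) Z]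
  (S : SignedSpace P F Z)

open Classical in
/-- The signs of the coordinates. -/
noncomputable def bits (z : Z) (i : ι) : ZMod 2 := if S.coord z i < 0 then 1 else 0

lemma bits_vadd_sec (z : Z) : S.bits z +ᵥ S.sec (S.point z) = z := by
  refine S.eq_of_coord_eq _ _ (funext fun i => ?_) (by rw [S.point_vadd, S.point_sec])
  have h1 := S.sec_nonneg (S.point z) i
  have h2 := sq_eq_sq_iff_abs_eq_abs _ _ |>.1 (S.coord_sq z i)
  rw [abs_of_nonneg h1] at h2
  rw [S.coord_vadd, h2, bits]
  split_ifs with h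
  · rw [bitSign_one, abs_of_neg h, neg_one_mul, neg_neg]
  · rw [bitSign_zero, abs_of_nonneg (not_lt.1 h), one_mul]

/-- A sign change can fix only a zero coordinate, so stabilizers are the coordinate subgroups of the
facets through the point. -/
lemma vadd_eq_self_iff {g : ι → ZMod 2} {z : Z} :
    g +ᵥ z = z ↔ ∀ i, g i ≠ 0 → (S.point z : E) ∈ F i := by
  constructor
  · intro h i hi
    rw [← S.coord_eq_zero_iff]
    by_contra h0
    have h1 := S.coord_vadd g z i
    rw [h, right_eq_mul₀ h0] at h1
    exact hi (bitSign_eq_one_iff.1 h1)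
  · intro h
    refine S.eq_of_coord_eq _ _ (funext fun i => ?_) (S.point_vadd g z)
    rw [S.coord_vadd]
    by_cases hi : g i = 0
    · rw [hi, bitSign_zero, one_mul]
    · rw [(S.coord_eq_zero_iff z i).2 (h i hi), mul_zero]

/-- The parametrization of the space by signs and points of `P`. -/
def param : (ι → ZMod 2) × P → Z := fun x => x.1 +ᵥ S.sec x.2

lemma continuous_param [Finite ι] : Continuous S.param :=
  continuous_prod_of_discrete_left.2 fun g => (S.sec.continuous).const_vadd g

lemma surjective_param : Function.Surjective S.param :=
  fun z => ⟨(S.bits z, S.point z), S.bits_vadd_sec z⟩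

lemma isQuotientMap_param [Finite ι] [CompactSpace P] [T2Space Z] :
    Topology.IsQuotientMap S.param :=
  S.continuous_param.isClosedMap.isQuotientMap S.continuous_param S.surjective_param

variable [Fintype ι] {n : ℕ} (lam : ι → Fin n → ZMod 2)

/-- The projection to the small cover. -/
noncomputable def projFun (z : Z) : SmallCover P F lam :=
  Quotient.mk (smallCoverSetoid P F lam) (facetHom lam (S.bits z), S.point z)

/-- Two sign vectors over `p` have the same image exactly when their sum is an element of the kernel
plus a vector supported on the facets through `p`; the latter are the sign changes that fix `sec p`.
-/
lemma mk_eq_mk_iff_param {g h : ι → ZMod 2} {p p' : P} :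
    (Quotient.mk (smallCoverSetoid P F lam) (facetHom lam g, p) =
        Quotient.mk (smallCoverSetoid P F lam) (facetHom lam h, p')) ↔
      ∃ k, facetHom lam k = 0 ∧ k +ᵥ S.param (h, p') = S.param (g, p) := by
  have hself : ∀ a : ι → ZMod 2, a + a = 0 := fun a => funext fun i => CharTwo.add_self_eq_zero _
  rw [SmallCover.mk_eq_mk_iff, mem_facetSubgroup_iff]
  constructor
  · rintro ⟨hp, c, hc, hgh⟩
    obtain rfl : p = p' := hp
    refine ⟨g + h + c, ?_, ?_⟩
    · rw [map_add, map_add, hgh]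
      exact zmod_two_add_self _
    · have h1 : c +ᵥ S.sec p = S.sec p := S.vadd_eq_self_iff.2 (by rwa [S.point_sec])
      change (g + h + c) +ᵥ (h +ᵥ S.sec p) = g +ᵥ S.sec p
      rw [vadd_vadd, show g + h + c + h = g + c + (h + h) by abel, hself, add_zero, ← vadd_vadd, h1]
  · rintro ⟨k, hk, h1⟩
    have hp := congrArg S.point h1
    simp only [param, S.point_vadd, S.point_sec] at hp
    obtain rfl : p' = p := hp
    refine ⟨rfl, g + h + k, ?_, by rw [map_add, hk, add_zero, map_add]⟩
    have h2 : (g + h + k) +ᵥ S.sec p' = S.sec p' := by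
      have h3 := congrArg (g +ᵥ ·) h1
      simp only [param, vadd_vadd, hself, zero_vadd] at h3
      rw [← h3]
      congr 1
      abel
    have := S.vadd_eq_self_iff.1 h2
    rwa [S.point_sec] at this

lemma projFun_param (x : (ι → ZMod 2) × P) :
    S.projFun lam (S.param x) =
      Quotient.mk (smallCoverSetoid P F lam) (facetHom lam x.1, x.2) :=
  (S.mk_eq_mk_iff_param lam).2 ⟨0, map_zero _, by
    rw [zero_vadd]
    exact (S.bits_vadd_sec _).symm⟩

lemma isQuotientMap_projFun [CompactSpace P] [T2Space Z]
    (hlam : Function.Surjective (facetHom lam)) : Topology.IsQuotientMap (S.projFun lam) := by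
  have h1 : Topology.IsQuotientMap fun x : (ι → ZMod 2) × P =>
      (Quotient.mk (smallCoverSetoid P F lam) (facetHom lam x.1, x.2) : SmallCover P F lam) := by
    have h2 : IsOpenQuotientMap (facetHom lam) :=
      ⟨hlam, continuous_of_discreteTopology, fun _ _ => isOpen_discrete _⟩
    have h3 := (h2.prodMap (IsOpenQuotientMap.id (X := P))).isQuotientMap
    exact (isQuotientMap_quot_mk (r := (smallCoverSetoid P F lam).r)).comp h3
  have e : (S.projFun lam) ∘ S.param = fun x : (ι → ZMod 2) × P =>
      (Quotient.mk (smallCoverSetoid P F lam) (facetHom lam x.1, x.2) : SmallCover P F lam) :=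
    funext (S.projFun_param lam)
  have hcont : Continuous (S.projFun lam) :=
    S.isQuotientMap_param.continuous_iff.2 (e ▸ h1.continuous)
  exact Topology.IsQuotientMap.of_comp S.continuous_param hcont (e ▸ h1)

/-- The group of the covering. -/
abbrev deck : AddSubgroup (ι → ZMod 2) := (LinearMap.ker (facetHom lam)).toAddSubgroup

lemma projFun_eq_iff {z z' : Z} :
    S.projFun lam z = S.projFun lam z' ↔ z ∈ AddAction.orbit (deck lam) z' := by
  obtain ⟨x, rfl⟩ := S.surjective_param z
  obtain ⟨x', rfl⟩ := S.surjective_param z'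
  rw [S.projFun_param, S.projFun_param]
  refine (S.mk_eq_mk_iff_param lam).trans ?_
  constructor
  · rintro ⟨k, hk, h⟩
    exact ⟨⟨k, hk⟩, h⟩
  · rintro ⟨⟨k, hk⟩, h⟩
    exact ⟨k, hk, h⟩

/-- Freeness is the characteristic condition: a kernel element fixing `z` is a linear relation among
the vectors of the facets through the point of `z`, hence zero. A free action of a finite group on a
compact Hausdorff space gives a covering. -/
theorem isAddQuotientCoveringMap_projFun [CompactSpace P] [T2Space Z]
    (hF : IsCharacteristicMap F lam) (hlam : Function.Surjective (facetHom lam)) :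
    IsAddQuotientCoveringMap (S.projFun lam) (deck lam) := by
  have hcancel : IsCancelVAdd (deck lam) Z := isCancelVAdd_iff_eq_zero_of_vadd_eq.2 fun k z h => by
    have h1 := S.vadd_eq_self_iff.1 (show (k : ι → ZMod 2) +ᵥ z = z from h)
    have h2 := hF {i | (S.point z : E) ∈ F i} ⟨S.point z, by simp⟩
    refine Subtype.ext (funext fun i => ?_)
    by_contra hi
    refine hi ((linearIndepOn_iff'.1 h2) (Finset.univ.filter fun i => (k : ι → ZMod 2) i ≠ 0) k
      (fun j hj => h1 j (by simpa using hj)) ?_ i (by simpa using hi))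
    have h3 : facetHom lam k = 0 := k.2
    rw [Fintype.linearCombination_apply] at h3
    rw [Finset.sum_filter]
    refine (Finset.sum_congr rfl fun j _ => ?_).trans h3
    split_ifs with hj
    · rfl
    · rw [not_not.1 hj, zero_smul]
  have : CompactSpace Z := S.surjective_param.compactSpace S.continuous_param
  have : ContinuousConstVAdd (deck lam) Z := ⟨fun k => continuous_const_vadd (k : ι → ZMod 2)⟩
  exact (S.isQuotientMap_projFun lam hlam).isAddQuotientCoveringMap_of_properlyDiscontinuousVAdd
    (S.projFun_eq_iff lam)

end SignedSpace

/-! ## The covering of a small cover over a product with a triangle -/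

namespace ConvexPolygon

variable {q : ℕ} (T : ConvexPolygon 3) (Q : ConvexPolygon q)

noncomputable instance : AddAction (ZMod 3 ⊕ ZMod q → ZMod 2) (unitSphere × Q.surface) where
  vadd g z := (unitSphere.flip (g ∘ Sum.inl) z.1, surface.flip (g ∘ Sum.inr) z.2)
  zero_vadd z := Prod.ext (DFunLike.congr_fun unitSphere.flip_zero z.1)
    (DFunLike.congr_fun surface.flip_zero z.2)
  add_vadd g h z := Prod.ext
    (DFunLike.congr_fun (unitSphere.flip_add (g ∘ Sum.inl) (h ∘ Sum.inl)) z.1)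
    (DFunLike.congr_fun (surface.flip_add (g ∘ Sum.inr) (h ∘ Sum.inr)) z.2)

instance : ContinuousConstVAdd (ZMod 3 ⊕ ZMod q → ZMod 2) (unitSphere × Q.surface) where
  continuous_const_vadd g := ((unitSphere.flip (g ∘ Sum.inl)).prodMap
    (surface.flip (g ∘ Sum.inr))).continuous

lemma height_opposite_pos (i : ZMod 3) : 0 < T.height i (T.vertex (i - 1)) :=
  T.height_vertex_pos ((by decide : ∀ i : ZMod 3, i - 1 ≠ i) i)
    ((by decide : ∀ i : ZMod 3, i - 1 ≠ i + 1) i)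

/-- Modulo three, `i - 1` is the vertex off the edge `i`. Weighting it by `w i` makes the `i`-th
barycentric coordinate vanish exactly on the `i`-th edge. -/
lemma height_sum_opposite {w : ZMod 3 → ℝ} (hw : ∑ i, w i = 1) (i : ZMod 3) :
    T.height i (∑ j, w j • T.vertex (j - 1)) = w i * T.height i (T.vertex (i - 1)) := by
  rw [T.height_sum i hw, Finset.sum_eq_single i]
  · intro j _ hj
    have h : ∀ i j : ZMod 3, j ≠ i → j - 1 = i ∨ j - 1 = i + 1 := by decide
    rw [T.height_vertex_eq_zero_iff.2 (h i j hj), mul_zero]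
  · exact fun h => absurd (Finset.mem_univ i) h

/-- Barycentric coordinates on a triangle. -/
lemma exists_barycentric {p : ℝ × ℝ} (hp : p ∈ T.carrier) :
    (∑ i, T.height i p / T.height i (T.vertex (i - 1)) = 1) ∧
      ∑ i, (T.height i p / T.height i (T.vertex (i - 1))) • T.vertex (i - 1) = p := by
  obtain ⟨w, -, h1, h2, -⟩ := T.exists_combo hp
  rw [finsum_eq_sum_of_fintype, ← (Equiv.subRight (1 : ZMod 3)).sum_comp] at h1 h2
  have e : ∀ i, T.height i p / T.height i (T.vertex (i - 1)) = w (i - 1) := fun i => by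
    rw [div_eq_iff (T.height_opposite_pos i).ne', ← h2]
    exact T.height_sum_opposite h1 i
  simp only [e]
  exact ⟨h1, h2⟩

/-- The point of a triangle whose barycentric coordinates are the squares of the coordinates of a
point of the sphere. -/
def trianglePoint (x : unitSphere) : ℝ × ℝ := ∑ i, x.1 i ^ 2 • T.vertex (i - 1)

lemma trianglePoint_mem (x : unitSphere) : T.trianglePoint x ∈ T.carrier :=
  T.convex_carrier.sum_mem (fun i _ => sq_nonneg (x.1 i)) x.2 fun i _ => T.vertex_mem (i - 1)

lemma height_trianglePoint (x : unitSphere) (i : ZMod 3) :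
    T.height i (T.trianglePoint x) = x.1 i ^ 2 * T.height i (T.vertex (i - 1)) :=
  T.height_sum_opposite x.2 i

lemma continuous_trianglePoint : Continuous T.trianglePoint := by
  refine continuous_finsetSum _ fun i _ => ?_
  exact (((continuous_apply i).comp continuous_subtype_val).pow 2).smul continuous_const

lemma trianglePoint_flip (g : ZMod 3 → ZMod 2) (x : unitSphere) :
    T.trianglePoint (unitSphere.flip g x) = T.trianglePoint x :=
  Finset.sum_congr rfl fun i _ => by
    rw [unitSphere.flip_apply, mul_pow, bitSign_sq, one_mul]

/-- The point of the sphere with given barycentric coordinates. -/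
noncomputable def triangleSec (p : T.carrier) : unitSphere :=
  ⟨fun i => √(T.height i p / T.height i (T.vertex (i - 1))), by
    change ∑ i, √(T.height i p / T.height i (T.vertex (i - 1))) ^ 2 = 1
    rw [← (T.exists_barycentric p.2).1]
    exact Finset.sum_congr rfl fun i _ => Real.sq_sqrt
      (div_nonneg (T.height_nonneg p.2 i) (T.height_opposite_pos i).le)⟩

lemma continuous_triangleSec : Continuous T.triangleSec :=
  Continuous.subtype_mk (continuous_pi fun i => Real.continuous_sqrt.comp
    (((T.continuous_height i).comp continuous_subtype_val).div_const _)) _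

lemma trianglePoint_triangleSec (p : T.carrier) : T.trianglePoint (T.triangleSec p) = p :=
  (Finset.sum_congr rfl fun i _ => congrArg (· • _) (Real.sq_sqrt
    (div_nonneg (T.height_nonneg p.2 i) (T.height_opposite_pos i).le))).trans
      (T.exists_barycentric p.2).2

lemma triangleSec_trianglePoint_sq (x : unitSphere) (i : ZMod 3) :
    (T.triangleSec ⟨_, T.trianglePoint_mem x⟩).1 i ^ 2 = x.1 i ^ 2 := by
  change √(T.height i (T.trianglePoint x) / _) ^ 2 = x.1 i ^ 2
  rw [height_trianglePoint, mul_div_cancel_right₀ _ (T.height_opposite_pos i).ne',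
    Real.sq_sqrt (sq_nonneg _)]

lemma coord_eq_zero_iff_trianglePoint (x : unitSphere) (i : ZMod 3) :
    x.1 i = 0 ↔ T.trianglePoint x ∈ T.edge i := by
  rw [← T.height_eq_zero_iff (T.trianglePoint_mem x), height_trianglePoint, mul_eq_zero,
    or_iff_left (T.height_opposite_pos i).ne', sq_eq_zero_iff]

/-- The product of the sphere, which is the surface over a triangle, with the surface over a
polygon. -/
noncomputable def signedSpace :
    SignedSpace (T.prod Q) (T.prodFacet Q) (unitSphere × Q.surface) where
  coord z := Sum.elim z.1.1 z.2.1.1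
  point := ⟨fun z => ⟨(T.trianglePoint z.1, z.2.1.2), T.trianglePoint_mem z.1, z.2.2.1⟩,
    ((T.continuous_trianglePoint.comp continuous_fst).prodMk
      (surface.continuous_point.comp continuous_snd)).subtype_mk _⟩
  sec := ⟨fun p => (T.triangleSec ⟨p.1.1, p.2.1⟩,
      ⟨(fun j => √(Q.height j p.1.2), p.1.2), p.2.2, fun j =>
        Real.sq_sqrt (Q.height_nonneg p.2.2 j)⟩), by
    refine Continuous.prodMk (T.continuous_triangleSec.comp (by fun_prop))
      (Continuous.subtype_mk (Continuous.prodMk (continuous_pi fun j => ?_) (by fun_prop)) _)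
    exact Real.continuous_sqrt.comp ((Q.continuous_height j).comp
      (continuous_snd.comp continuous_subtype_val))⟩
  coord_vadd g z i := by
    cases i <;> rfl
  point_vadd g z := Subtype.ext (Prod.ext (T.trianglePoint_flip _ z.1) rfl)
  coord_eq_zero_iff z i := by
    rcases i with i | j
    · exact (T.coord_eq_zero_iff_trianglePoint z.1 i).trans (and_iff_left z.2.2.1).symm
    · exact ((surface.coord_eq_zero_iff z.2 j).trans (Q.height_eq_zero_iff z.2.2.1 j)).trans
        (and_iff_right (T.trianglePoint_mem z.1)).symm
  point_sec p := Subtype.ext (Prod.ext (T.trianglePoint_triangleSec _) rfl)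
  sec_nonneg p i := by
    cases i <;> exact Real.sqrt_nonneg _
  coord_sq z i := by
    rcases i with i | j
    · exact T.triangleSec_trianglePoint_sq z.1 i
    · exact (Real.sq_sqrt (Q.height_nonneg z.2.2.1 j)).trans (z.2.2.2 j).symm
  eq_of_coord_eq z z' h1 h2 := by
    refine Prod.ext (Subtype.ext (funext fun i => congrFun h1 (.inl i))) ?_
    exact surface.ext (fun j => congrFun h1 (.inr j))
      (congrArg (fun p : T.prod Q => p.1.2) h2)

instance : CompactSpace (T.prod Q) := by
  have := T.neZero
  have := Q.neZero
  refine isCompact_iff_compactSpace.1 (IsCompact.prod ?_ ?_)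
  · exact (Set.finite_range _).isCompact_convexHull (𝕜 := ℝ)
  · exact (Set.finite_range _).isCompact_convexHull (𝕜 := ℝ)

/-! ### Linear algebra of the characteristic map. -/

variable {T Q} {lam : ZMod 3 ⊕ ZMod q → Fin 4 → ZMod 2}

/-- The facets at a vertex. -/
abbrev vertexFacets (i : ZMod 3) (j : ZMod q) : Finset (ZMod 3 ⊕ ZMod q) :=
  Finset.disjSum {i - 1, i} {j - 1, j}

lemma linearIndepOn_vertexFacets (hlam : IsCharacteristicMap (T.prodFacet Q) lam) (i : ZMod 3)
    (j : ZMod q) : LinearIndepOn (ZMod 2) lam (vertexFacets i j : Set (ZMod 3 ⊕ ZMod q)) := by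
  refine hlam _ ⟨(T.vertex i, Q.vertex j), Set.mem_iInter₂.2 fun k hk => ?_⟩
  rw [Finset.mem_coe, Finset.mem_disjSum] at hk
  rcases hk with ⟨i', hi, rfl⟩ | ⟨j', hj, rfl⟩
  · refine ⟨(T.height_eq_zero_iff (T.vertex_mem _) _).1 (((T.isCenter_vertex i).2 i').2 ?_),
      Q.vertex_mem _⟩
    simpa using hi
  · refine ⟨T.vertex_mem _,
      (Q.height_eq_zero_iff (Q.vertex_mem _) _).1 (((Q.isCenter_vertex j).2 j').2 ?_)⟩
    simpa using hj

lemma card_pred_pair {r : ℕ} (A : ConvexPolygon r) (i : ZMod r) :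
    Finset.card {i - 1, i} = 2 :=
  Finset.card_pair fun h => A.one_ne_zero (sub_eq_self.1 h)

lemma surjective_facetHom [Fintype (ZMod q)] (hlam : IsCharacteristicMap (T.prodFacet Q) lam) :
    Function.Surjective (facetHom lam) := by
  have h := linearIndepOn_vertexFacets hlam 0 0
  have h1 := h.linearIndependent.span_eq_top_of_card_eq_finrank' (by
    rw [← Set.toFinset_card, Finset.toFinset_coe, Finset.card_disjSum, card_pred_pair T,
      card_pred_pair Q, Module.finrank_fin_fun])
  rw [← LinearMap.range_eq_top, Fintype.range_linearCombination, eq_top_iff, ← h1]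
  refine Submodule.span_mono ?_
  rintro _ ⟨x, rfl⟩
  exact ⟨x.1, rfl⟩

/-- The vectors of the edges of the triangle have their sum in the span of the vectors of two
adjacent edges of the polygon. -/
lemma exists_mem_deck [Fintype (ZMod q)] (hlam : IsCharacteristicMap (T.prodFacet Q) lam) :
    ∃ g ∈ SignedSpace.deck lam, ∀ i, g (Sum.inl i) = 1 := by
  classical
  have h01 : ∀ a : ZMod 2, a = 0 ∨ a = 1 := by decide
  -- All three edges of the triangle and the two edges at the vertex `0` of the polygon: five
  -- vectors in a space of dimension four.
  let s : Finset (ZMod 3 ⊕ ZMod q) := Finset.disjSum Finset.univ {(0 : ZMod q) - 1, 0}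
  have hdep : ¬ LinearIndepOn (ZMod 2) lam (s : Set (ZMod 3 ⊕ ZMod q)) := fun h => by
    have := h.linearIndependent.fintype_card_le_finrank
    rw [← Set.toFinset_card, Finset.toFinset_coe, Finset.card_disjSum, card_pred_pair Q,
      Module.finrank_fin_fun, Finset.card_univ, ZMod.card] at this
    omega
  rw [linearIndepOn_finset_iff] at hdep
  push Not at hdep
  obtain ⟨f, hf, x, hx, hfx⟩ := hdep
  let g : ZMod 3 ⊕ ZMod q → ZMod 2 := fun i => if i ∈ s then f i else 0
  have hg : ∑ i ∈ s, g i • lam i = 0 := by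
    rw [← hf]
    exact Finset.sum_congr rfl fun i hi => by rw [show g i = f i from if_pos hi]
  refine ⟨g, ?_, fun i => (h01 _).resolve_left fun hi => hfx ?_⟩
  · change facetHom lam g = 0
    rw [Fintype.linearCombination_apply, ← hg]
    refine (Finset.sum_subset (Finset.subset_univ s) fun j _ hj => ?_).symm
    rw [show g j = 0 from if_neg hj, zero_smul]
  -- If the coefficient of the triangle edge `i` were zero, the relation would live on the four
  -- facets at the vertex opposite that edge, where the vectors are independent.
  · have hsub : vertexFacets (i - 1) 0 ⊆ s := Finset.disjSum_mono (Finset.subset_univ _) subset_rfl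
    have hout : ∀ j ∈ s, j ∉ vertexFacets (i - 1) 0 → g j = 0 := fun j hj hj' => by
      rw [Finset.mem_disjSum] at hj hj'
      push Not at hj'
      rcases hj with ⟨k, -, rfl⟩ | ⟨k, hk, rfl⟩
      · have h3 : ∀ i k : ZMod 3, k = i ∨ k ∈ ({i - 1 - 1, i - 1} : Finset (ZMod 3)) := by decide
        rcases h3 i k with rfl | h
        · exact hi
        · exact absurd rfl (hj'.1 k h)
      · exact absurd rfl (hj'.2 k hk)
    have h := linearIndepOn_finset_iff.1 (linearIndepOn_vertexFacets hlam (i - 1) 0) g (by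
      rw [← hg]
      refine Finset.sum_subset hsub fun j hj hj' => ?_
      rw [hout j hj hj', zero_smul])
    rw [← show g x = f x from if_pos hx]
    by_cases hx' : x ∈ vertexFacets (i - 1) 0
    · exact h x hx'
    · exact hout x hx hx'

end ConvexPolygon

/-! ## The cup square -/

namespace ConvexPolygon.surface

open SingularCochain

variable {q : ℕ} {Q : ConvexPolygon q}

/-- Invariant classes of degree two restrict to zero on the spheres. -/
lemma isCob_pull_slice {b : Coch 2 (unitSphere × Q.surface)} (hb : IsCocycle b)
    {g : ZMod 3 → ZMod 2} {h : ZMod q → ZMod 2} (hg : ∑ i, g i = 1)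
    (hinv : pull ((unitSphere.flip g).prodMap (flip h)) b = b) (z : Q.surface) :
    IsCob (pull (slice unitSphere z) b) := by
  obtain ⟨γ⟩ := joined_flip h z
  let F : (slice unitSphere z).Homotopy (slice unitSphere (flip h z)) :=
    { toFun := fun p => (p.2, γ p.1)
      continuous_toFun := by fun_prop
      map_zero_left := fun x => Prod.ext rfl γ.source
      map_one_left := fun x => Prod.ext rfl γ.target }
  have h1 := (isCob_pull_sub_pull F hb).pull (unitSphere.flip g)
  have h2 := unitSphere.isCob_add_pull_flip hg (hb.pull (slice unitSphere z))
  have e : pull (unitSphere.flip g) (pull (slice unitSphere (flip h z)) b) =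
      pull (slice unitSphere z) b := by
    conv_rhs => rw [← hinv]
    rfl
  rw [map_sub, e] at h1
  -- With `r` the restriction to the slice and `φ` the sign change of the sphere, invariance and the
  -- path from `z` to its image give `r ~ φ*r`, while the odd number of reflections gives `r ~
  -- -φ*r`. Hence `2r ~ 0`.
  have h3 := (h1.add h2).smul (1 / 2)
  rw [sub_add_add_cancel] at h3
  convert h3 using 1
  module

/-- The square of an invariant class of degree two vanishes. -/
lemma isCob_cup_self {b : Coch 2 (unitSphere × Q.surface)} (hb : IsCocycle b)
    (hs : ∀ z : Q.surface, IsCob (pull (slice unitSphere z) b)) :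
    IsCob (cup (n := 4) rfl b b) := by
  have hV : IsCob (pull (val (slab unitSphere (star Q {0 - 1, 0}))) b) :=
    isCob_slab_star (isCenter_vertex Q 0) (hb.pull _) fun z _ => hs z
  -- The cover consists of the part over `q - 1` consecutive vertex stars and the part over the
  -- remaining star.
  refine isCob_cup_of_cover (p := 1) (q := 1) (n := 3) (U := slab unitSphere (chain Q 0 (q - 2)))
    (V := slab unitSphere (star Q {0 - 1, 0})) rfl
    ((isOpen_chain 0 (q - 2)).preimage continuous_snd)
    ((isOpen_star {(0 : ZMod q) - 1, 0}).preimage continuous_snd) ?_ hb hb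
    (isCob_slab_chain (fun c hc => unitSphere.isCob_one hc) hb hs 0 (m := q - 2)
      (by have := Q.three_le; omega))
    hV
  rw [← Set.preimage_union, chain_union_star, Set.preimage_univ]

end ConvexPolygon.surface

open SingularCochain ConvexPolygon in
theorem mainTheorem10 (q : ℕ) (T : ConvexPolygon 3) (Q : ConvexPolygon q)
    (lam : ZMod 3 ⊕ ZMod q → Fin 4 → ZMod 2)
    (hlam : IsCharacteristicMap (T.prodFacet Q) lam) :
    ¬ IsCSymplectic 2 (SmallCover (T.prod Q) (T.prodFacet Q) lam) := by
  have := Q.neZero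
  have hcov := (signedSpace T Q).isAddQuotientCoveringMap_projFun lam hlam
    (surjective_facetHom hlam)
  let π : C(unitSphere × Q.surface, SmallCover (T.prod Q) (T.prodFacet Q) lam) :=
    ⟨(signedSpace T Q).projFun lam, hcov.continuous⟩
  refine not_isCSymplectic_two fun a ha => isCob_of_pull_covering (π := π) hcov ?_
  obtain ⟨g, hg, hg1⟩ := exists_mem_deck hlam
  refine surface.isCob_cup_self (ha.pull π) (surface.isCob_pull_slice (ha.pull π)
    (g := g ∘ Sum.inl) (h := g ∘ Sum.inr) ?_ ?_)
  -- The element flips all three coordinates of the sphere, and three is odd: it is the antipodal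
  -- map.
  · simp only [Function.comp_apply, hg1]
    decide
  · rw [← pull_comp]
    refine congrArg (fun f : C(_, _) => pull f a) (ContinuousMap.ext fun z => ?_)
    exact ((signedSpace T Q).projFun_eq_iff lam).2 ⟨⟨g, hg⟩, rfl⟩
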